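/- Let $\mathbb{T}=\mathbb{R}/\mathbb{Z}$. For integers $N,M\ge 1$ let $L^2_{N,M}=L^2(\mathbb{T}^N\to\mathbb{C}^M)$ (Lebesgue measure). For $i\in\{1,\dots,N\}$ and rational $h\neq 0$ define the finite derivative $\mathcal{D}_{i,h}$ on $L^2_{N,M}$ by $$\mathcal{D}_{i,h}\mathbf{u}(\mathbf{x})=\frac{\mathbf{u}(\mathbf{x}+h\mathbf{e}_i)-\mathbf{u}(\mathbf{x})}{h},$$ where $\mathbf{e}_i$ is the $i$-th standard basis vector. Let $R^\infty_{N,M}$ be the set of functions $\mathbf{S}:\mathbb{T}^N\to\mathbb{C}^{M\times M}$ that are uniform limits of step functions $\sum_{n=1}^P\chi_{J_n}\mathbf{S}_n$, where $P\in\mathbb{N}$, $\mathbf{S}_n\in\mathbb{C}^{M\times M}$ and each $J_n=\prod_{i=1}^N[p_{in},q_{in})\subset\mathbb{T}^N$ is a product of half-open arcs with rational end points; for $\mathbf{S}\in R^\infty_{N,M}$ let $\mathcal{M}_{\mathbf{S}}\mathbf{u}(\mathbf{x})=\mathbf{S}(\mathbf{x})\mathbf{u}(\mathbf{x})$ on $L^2_{N,M}$.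 Let $\mathscr{H}_{N,M}$ be the norm closure, in the bounded operators on $L^2_{N,M}$, of the algebra generated by all $\mathcal{D}_{i,h}$ and all $\mathcal{M}_{\mathbf{S}}$; it is a unital $C^*$-algebra. Let $\mathscr{U}=\bigotimes_{n=1}^\infty\mathbb{C}^{n\times n}$ be the universal UHF algebra, that is, the $C^*$-inductive limit of $$\mathbb{C}^{1\times1}\to\mathbb{C}^{2\times2}\to\mathbb{C}^{6\times6}\to\cdots\to\mathbb{C}^{n!\times n!}\to\cdots$$ along the unital $*$-embeddings $a\mapsto\mathrm{diag}(a,\dots,a)$. **Theorem.** For all integers $N,M\ge1$, the $C^*$-algebra $\mathscr{H}_{N,M}$ is $*$-isomorphic to $\mathscr{U}$. Moreover, there is a unitary $\mathcal{U}_{N,M}:L^2_{1,1}\to L^2_{N,M}$ such that $\mathscr{H}_{1,1}=\mathcal{U}_{N,M}^{-1}\,\mathscr{H}_{N,M}\,\mathcal{U}_{N,M}$. -/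

import Mathlib

open scoped Matrix.Norms.L2Operator

noncomputable section

/-! ### Finite differential operators on the torus -/

namespace FiniteDiff

open MeasureTheory

/-- The torus `𝕋ᴺ`, where `𝕋 = ℝ/ℤ`. It carries the product of the Lebesgue measures. -/
abbrev Torus (N : ℕ) : Type := Fin N → UnitAddCircle

/-- The Hilbert space `L²(𝕋ᴺ → ℂᴹ)`. -/
abbrev L2 (N M : ℕ) : Type :=
  Lp (EuclideanSpace ℂ (Fin M)) 2 (volume : Measure (Torus N))

/-- The half-open arc `[p, q)` of the circle: the image of the real interval `[p, q)`. -/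
def arc (p q : ℚ) : Set UnitAddCircle :=
  (fun t : ℝ => (t : UnitAddCircle)) '' Set.Ico (p : ℝ) (q : ℝ)

/-- The parallelepiped `∏ i, [p i, q i)` in the torus. -/
def box {N : ℕ} (p q : Fin N → ℚ) : Set (Torus N) :=
  Set.univ.pi fun i => arc (p i) (q i)

/-- The step function `x ↦ ∑ n, χ_{Jₙ}(x) Sₙ`, with `Jₙ = ∏ i, [p n i, q n i)`. -/
def stepFun {N M P : ℕ} (p q : Fin P → Fin N → ℚ) (S : Fin P → Matrix (Fin M) (Fin M) ℂ) :
    Torus N → Matrix (Fin M) (Fin M) ℂ :=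
  fun x => ∑ n, (box (p n) (q n)).indicator (fun _ => S n) x

/-- The matrix-valued regulated functions with rational discontinuities: the uniform limits of
step functions on parallelepipeds with rational end points. -/
def Regulated (N M : ℕ) : Set (Torus N → Matrix (Fin M) (Fin M) ℂ) :=
  {S | ∀ ε : ℝ, 0 < ε → ∃ (P : ℕ) (p q : Fin P → Fin N → ℚ) (C : Fin P → Matrix (Fin M) (Fin M) ℂ),
    ∀ x, ‖S x - stepFun p q C x‖ ≤ ε}

lemma measurableSet_arc (p q : ℚ) : MeasurableSet (arc p q) := by
  unfold arc
  rcases le_or_gt ((p : ℝ) + 1) q with h | h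
  · have : (fun t : ℝ => (t : UnitAddCircle)) '' Set.Ico (p : ℝ) (q : ℝ) = Set.univ := by
      apply Set.eq_univ_of_univ_subset
      rw [← AddCircle.coe_image_Ico_eq (1 : ℝ) (p : ℝ)]
      exact Set.image_mono (Set.Ico_subset_Ico_right h)
    rw [this]; exact MeasurableSet.univ
  · apply measurableSet_Ico.image_of_measurable_injOn AddCircle.measurable_mk'
    intro x hx y hy hxy
    have hs : Set.Ico (p : ℝ) q ⊆ Set.Ico (p : ℝ) (p + 1) := Set.Ico_subset_Ico_right h.le
    exact (AddCircle.coe_eq_coe_iff_of_mem_Ico (hs hx) (hs hy)).1 hxy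

lemma measurableSet_box {N : ℕ} (p q : Fin N → ℚ) : MeasurableSet (box p q) :=
  MeasurableSet.univ_pi fun _ => measurableSet_arc _ _

lemma stronglyMeasurable_stepFun {N M P : ℕ} (p q : Fin P → Fin N → ℚ)
    (S : Fin P → Matrix (Fin M) (Fin M) ℂ) : StronglyMeasurable (stepFun p q S) := by
  unfold stepFun
  exact Finset.stronglyMeasurable_fun_sum _ fun n _ =>
    stronglyMeasurable_const.indicator (measurableSet_box _ _)

lemma norm_stepFun_le {N M P : ℕ} (p q : Fin P → Fin N → ℚ)
    (S : Fin P → Matrix (Fin M) (Fin M) ℂ) (x : Torus N) : ‖stepFun p q S x‖ ≤ ∑ n, ‖S n‖ :=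
  (norm_sum_le _ _).trans <| Finset.sum_le_sum fun _ _ => norm_indicator_le_norm_self _ _

lemma Regulated.stronglyMeasurable {N M : ℕ} {S : Torus N → Matrix (Fin M) (Fin M) ℂ}
    (hS : S ∈ Regulated N M) : StronglyMeasurable S := by
  have hpos : ∀ n : ℕ, (0 : ℝ) < 1 / ((n : ℝ) + 1) := fun n => by positivity
  choose P p q C h using fun n : ℕ => hS _ (hpos n)
  refine stronglyMeasurable_of_tendsto Filter.atTop
    (fun n => stronglyMeasurable_stepFun (p n) (q n) (C n)) ?_
  rw [tendsto_pi_nhds]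
  intro x
  rw [tendsto_iff_norm_sub_tendsto_zero]
  refine squeeze_zero (fun _ => norm_nonneg _) (fun n => ?_) tendsto_one_div_add_atTop_nhds_zero_nat
  rw [norm_sub_rev]
  exact h n x

lemma Regulated.exists_bound {N M : ℕ} {S : Torus N → Matrix (Fin M) (Fin M) ℂ}
    (hS : S ∈ Regulated N M) : ∃ K : ℝ, ∀ x, ‖S x‖ ≤ K := by
  obtain ⟨P, p, q, C, h⟩ := hS 1 one_pos
  refine ⟨1 + ∑ n, ‖C n‖, fun x => ?_⟩
  calc ‖S x‖ = ‖(S x - stepFun p q C x) + stepFun p q C x‖ := by rw [sub_add_cancel]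
    _ ≤ _ := (norm_add_le _ _).trans (add_le_add (h x) (norm_stepFun_le _ _ _ _))

lemma Regulated.memLp {N M : ℕ} {S : Torus N → Matrix (Fin M) (Fin M) ℂ}
    (hS : S ∈ Regulated N M) :
    MemLp (fun x => Matrix.toEuclideanCLM (n := Fin M) (𝕜 := ℂ) (S x)) ⊤
      (volume : Measure (Torus N)) := by
  obtain ⟨K, hK⟩ := Regulated.exists_bound hS
  have hc : Continuous (Matrix.toEuclideanCLM (n := Fin M) (𝕜 := ℂ)) :=
    (Matrix.toEuclideanCLM (n := Fin M) (𝕜 := ℂ)).toAlgEquiv.toLinearMap.continuous_of_finiteDimensional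
  exact memLp_top_of_bound
    (hc.comp_stronglyMeasurable (Regulated.stronglyMeasurable hS)).aestronglyMeasurable K
    (Filter.Eventually.of_forall fun x => hK x)

lemma Regulated.star_mem {N M : ℕ} {S : Torus N → Matrix (Fin M) (Fin M) ℂ}
    (hS : S ∈ Regulated N M) : (fun x => star (S x)) ∈ Regulated N M := by
  intro ε hε
  obtain ⟨P, p, q, C, h⟩ := hS ε hε
  refine ⟨P, p, q, fun n => star (C n), fun x => ?_⟩
  have : stepFun p q (fun n => star (C n)) x = star (stepFun p q C x) := by
    simp only [stepFun, star_sum]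
    refine Finset.sum_congr rfl fun n _ => ?_
    by_cases hx : x ∈ box (p n) (q n) <;> simp [hx]
  rw [this, ← star_sub, norm_star]
  exact h x

/-- The operator `u(x) ↦ S(x) u(x)` of multiplication by a regulated function `S`. -/
def mulOp {N M : ℕ} (S : Torus N → Matrix (Fin M) (Fin M) ℂ) (hS : S ∈ Regulated N M) :
    L2 N M →L[ℂ] L2 N M :=
  (ContinuousLinearMap.id ℂ
      (EuclideanSpace ℂ (Fin M) →L[ℂ] EuclideanSpace ℂ (Fin M))).holderL volume ⊤ 2 2
    ((Regulated.memLp hS).toLp _)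

lemma coeFn_mulOp {N M : ℕ} (S : Torus N → Matrix (Fin M) (Fin M) ℂ) (hS : S ∈ Regulated N M)
    (u : L2 N M) :
    ⇑(mulOp S hS u) =ᵐ[volume] fun x => Matrix.toEuclideanCLM (n := Fin M) (𝕜 := ℂ) (S x) (u x) := by
  refine (ContinuousLinearMap.coeFn_holder _ _ _).trans ?_
  filter_upwards [(Regulated.memLp hS).coeFn_toLp] with x hx
  rw [hx]; rfl

/-- The translation operator `u(x) ↦ u(x + h eᵢ)`. -/
def shiftOp {N M : ℕ} (i : Fin N) (h : ℚ) : L2 N M →L[ℂ] L2 N M :=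
  (Lp.compMeasurePreservingₗᵢ ℂ (fun x : Torus N => x + Pi.single i ((h : ℝ) : UnitAddCircle))
    (measurePreserving_add_right volume _)).toContinuousLinearMap

/-- The finite derivative `u(x) ↦ (u(x + h eᵢ) - u(x)) / h`. -/
def diffOp {N M : ℕ} (i : Fin N) (h : ℚ) : L2 N M →L[ℂ] L2 N M :=
  ((h : ℂ)⁻¹) • (shiftOp i h - 1)

/-- All finite derivatives `D_{i,h}` with rational `h ≠ 0` and all operators of multiplication by
regulated functions with rational discontinuities. -/
def generators (N M : ℕ) : Set (L2 N M →L[ℂ] L2 N M) :=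
  {A | ∃ (i : Fin N) (h : ℚ), h ≠ 0 ∧ A = diffOp i h} ∪
    {A | ∃ (S : Torus N → Matrix (Fin M) (Fin M) ℂ) (hS : S ∈ Regulated N M), A = mulOp S hS}

lemma star_mulOp {N M : ℕ} (S : Torus N → Matrix (Fin M) (Fin M) ℂ) (hS : S ∈ Regulated N M) :
    star (mulOp S hS) = mulOp (fun x => star (S x)) (Regulated.star_mem hS) := by
  symm
  rw [ContinuousLinearMap.star_eq_adjoint, ContinuousLinearMap.eq_adjoint_iff]
  intro u v
  rw [L2.inner_def, L2.inner_def]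
  refine integral_congr_ae ?_
  filter_upwards [coeFn_mulOp _ (Regulated.star_mem hS) u, coeFn_mulOp S hS v] with x h1 h2
  rw [h1, h2, map_star, ContinuousLinearMap.star_eq_adjoint,
    ContinuousLinearMap.adjoint_inner_left]

lemma star_shiftOp {N M : ℕ} (i : Fin N) (h : ℚ) :
    star (shiftOp i h : L2 N M →L[ℂ] L2 N M) = shiftOp i (-h) := by
  symm
  rw [ContinuousLinearMap.star_eq_adjoint, ContinuousLinearMap.eq_adjoint_iff]
  intro u v
  have key : shiftOp i h (shiftOp i (-h) u) = u := by
    simp only [shiftOp, LinearIsometry.coe_toContinuousLinearMap]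
    refine Eq.trans (Lp.compMeasurePreserving_comp_apply _ _ _).symm ?_
    apply Lp.ext
    refine (Lp.coeFn_compMeasurePreserving _ _).trans (Filter.EventuallyEq.of_eq ?_)
    funext x
    simp [← Pi.single_add]
  let T : L2 N M →ₗᵢ[ℂ] L2 N M := Lp.compMeasurePreservingₗᵢ ℂ
    (fun x : Torus N => x + Pi.single i ((h : ℝ) : UnitAddCircle))
    (measurePreserving_add_right volume _)
  have hi : inner ℂ (shiftOp i h (shiftOp i (-h) u)) (shiftOp i h v) =
      inner ℂ (shiftOp i (-h) u) v := T.inner_map_map _ _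
  rw [← hi, key]

lemma star_diffOp {N M : ℕ} (i : Fin N) (h : ℚ) :
    star (diffOp i h : L2 N M →L[ℂ] L2 N M) = -diffOp i (-h) := by
  simp [diffOp, star_smul, star_sub, star_shiftOp]

/-- The algebra generated by the finite derivatives and the multiplication operators: the linear
span of all their products. It is closed under adjoints. -/
def finDiffAlgebraic (N M : ℕ) : StarSubalgebra ℂ (L2 N M →L[ℂ] L2 N M) where
  toSubalgebra := Algebra.adjoin ℂ (generators N M)
  star_mem' := by
    intro a ha
    have hle : Algebra.adjoin ℂ (generators N M) ≤ star (Algebra.adjoin ℂ (generators N M)) := by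
      refine Algebra.adjoin_le ?_
      rintro A (⟨i, h, hh, rfl⟩ | ⟨S, hS, rfl⟩)
      · change star (diffOp i h) ∈ Algebra.adjoin ℂ (generators N M)
        rw [star_diffOp]
        exact neg_mem (Algebra.subset_adjoin (Or.inl ⟨i, -h, neg_ne_zero.2 hh, rfl⟩))
      · change star (mulOp S hS) ∈ Algebra.adjoin ℂ (generators N M)
        rw [star_mulOp]
        exact Algebra.subset_adjoin (Or.inr ⟨_, _, rfl⟩)
    exact hle ha

/-- The `C⋆`-algebra `H_{N,M}` of finite differential operators: the norm closure, in the bounded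
operators on `L²(𝕋ᴺ → ℂᴹ)`, of the algebra generated by the finite derivatives and the
multiplication operators. -/
def finDiffAlg (N M : ℕ) : StarSubalgebra ℂ (L2 N M →L[ℂ] L2 N M) :=
  (finDiffAlgebraic N M).topologicalClosure

end FiniteDiff

/-! ### The universal UHF algebra -/

namespace UHF

open scoped Nat

/-- The unital `⋆`-embedding `a ↦ diag(a, a, …, a)` of `ℂ^{m×m}` into `ℂ^{n×n}`, for `m ∣ n`. -/
def blockDiagHom (m n : ℕ) [NeZero m] (h : m ∣ n) :
    Matrix (Fin m) (Fin m) ℂ →⋆ₐ[ℂ] Matrix (Fin n) (Fin n) ℂ where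
  toFun a := Matrix.of fun i j =>
    if (i : ℕ) / m = (j : ℕ) / m then a (Fin.ofNat m i) (Fin.ofNat m j) else 0
  map_one' := by
    ext i j
    have h1 : Fin.ofNat m i = Fin.ofNat m j ↔ (i : ℕ) % m = (j : ℕ) % m := by
      simp [Fin.ext_iff]
    have h2 : i = j ↔ (i : ℕ) / m = (j : ℕ) / m ∧ (i : ℕ) % m = (j : ℕ) % m :=
      ⟨fun e => by rw [e]; exact ⟨rfl, rfl⟩, fun ⟨e1, e2⟩ => Fin.ext <| by
        rw [← Nat.div_add_mod (i : ℕ) m, ← Nat.div_add_mod (j : ℕ) m, e1, e2]⟩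
    simp only [Matrix.of_apply, Matrix.one_apply, h1, h2]
    split_ifs <;> simp_all
  map_mul' a b := by
    obtain ⟨q, rfl⟩ := h
    ext i j
    have hm : 0 < m := Nat.pos_of_ne_zero (NeZero.ne m)
    let e : Fin q × Fin m ≃ Fin (m * q) := finProdFinEquiv.trans (finCongr (mul_comm q m))
    have he : ∀ c k, ((e (c, k) : Fin (m * q)) : ℕ) = k + m * c := fun c k => rfl
    have hdiv : ∀ c k, ((e (c, k) : Fin (m * q)) : ℕ) / m = c := fun c k => by
      rw [he, Nat.add_mul_div_left _ _ hm, Nat.div_eq_of_lt k.2, zero_add]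
    have hmod : ∀ c k, Fin.ofNat m ((e (c, k) : Fin (m * q)) : ℕ) = k := fun c k => by
      apply Fin.ext
      simp only [Fin.val_ofNat]
      rw [he, Nat.add_mul_mod_self_left, Nat.mod_eq_of_lt k.2]
    obtain ⟨⟨c, k⟩, rfl⟩ := e.surjective i
    obtain ⟨⟨d, l⟩, rfl⟩ := e.surjective j
    rw [Matrix.mul_apply, ← e.sum_comp, Fintype.sum_prod_type]
    simp only [Matrix.of_apply, hdiv, hmod, Matrix.mul_apply]
    rw [Finset.sum_eq_single c]
    · simp only [if_true]
      by_cases hcd : (c : ℕ) = d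
      · simp [hcd]
      · simp [hcd]
    · intro c' _ hc'
      have : (c : ℕ) ≠ c' := fun h' => hc' (Fin.ext h'.symm)
      simp [this]
    · simp
  map_zero' := by ext i j; simp
  map_add' a b := by
    ext i j
    simp only [Matrix.of_apply, Matrix.add_apply]
    split_ifs <;> simp
  commutes' r := by
    ext i j
    have h1 : Fin.ofNat m i = Fin.ofNat m j ↔ (i : ℕ) % m = (j : ℕ) % m := by
      simp [Fin.ext_iff]
    have h2 : i = j ↔ (i : ℕ) / m = (j : ℕ) / m ∧ (i : ℕ) % m = (j : ℕ) % m :=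
      ⟨fun e => by rw [e]; exact ⟨rfl, rfl⟩, fun ⟨e1, e2⟩ => Fin.ext <| by
        rw [← Nat.div_add_mod (i : ℕ) m, ← Nat.div_add_mod (j : ℕ) m, e1, e2]⟩
    simp only [Matrix.of_apply, Matrix.algebraMap_matrix_apply, h1, h2]
    split_ifs <;> simp_all
  map_star' a := by
    ext i j
    simp only [Matrix.of_apply, Matrix.star_apply, eq_comm (a := (i : ℕ) / m)]
    split_ifs <;> simp

lemma blockDiagHom_apply (m n : ℕ) [NeZero m] (h : m ∣ n) (a : Matrix (Fin m) (Fin m) ℂ)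
    (i j : Fin n) : blockDiagHom m n h a i j =
      if (i : ℕ) / m = (j : ℕ) / m then a (Fin.ofNat m i) (Fin.ofNat m j) else 0 := rfl

lemma blockDiagHom_self (m : ℕ) [NeZero m] (a : Matrix (Fin m) (Fin m) ℂ) :
    blockDiagHom m m dvd_rfl a = a := by
  ext i j
  have hi : Fin.ofNat m i = i := Fin.ext (Nat.mod_eq_of_lt i.2)
  have hj : Fin.ofNat m j = j := Fin.ext (Nat.mod_eq_of_lt j.2)
  rw [blockDiagHom_apply, Nat.div_eq_of_lt i.2, Nat.div_eq_of_lt j.2, if_pos rfl, hi, hj]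

lemma blockDiagHom_comp (k m n : ℕ) [NeZero k] [NeZero m] (h1 : k ∣ m) (h2 : m ∣ n)
    (a : Matrix (Fin k) (Fin k) ℂ) :
    blockDiagHom m n h2 (blockDiagHom k m h1 a) = blockDiagHom k n (h1.trans h2) a := by
  ext i j
  have hr : ∀ x : ℕ, Fin.ofNat k ((Fin.ofNat m x : Fin m) : ℕ) = Fin.ofNat k x := fun x =>
    Fin.ext (Nat.mod_mod_of_dvd x h1)
  have hd : (i : ℕ) / k = (j : ℕ) / k ↔
      (i : ℕ) / m = (j : ℕ) / m ∧ (i : ℕ) % m / k = (j : ℕ) % m / k := by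
    obtain ⟨c, rfl⟩ := h1
    simp only [Nat.mod_mul_right_div_self, ← Nat.div_div_eq_div_mul]
    refine ⟨fun e => by rw [e]; exact ⟨rfl, rfl⟩, fun ⟨e1, e2⟩ => ?_⟩
    rw [← Nat.div_add_mod ((i : ℕ) / k) c, ← Nat.div_add_mod ((j : ℕ) / k) c, e1, e2]
  simp only [blockDiagHom_apply, hr, hd]
  simp only [Fin.val_ofNat]
  split_ifs <;> simp_all

lemma blockDiagHom_injective (m n : ℕ) [NeZero m] [NeZero n] (h : m ∣ n) :
    Function.Injective (blockDiagHom m n h) := by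
  intro a b hab
  ext i j
  have hle : m ≤ n := Nat.le_of_dvd (Nat.pos_of_ne_zero (NeZero.ne n)) h
  have := congrFun (congrFun hab (Fin.castLE hle i)) (Fin.castLE hle j)
  have hi : Fin.ofNat m i = i := Fin.ext (Nat.mod_eq_of_lt i.2)
  have hj : Fin.ofNat m j = j := Fin.ext (Nat.mod_eq_of_lt j.2)
  simpa only [blockDiagHom_apply, Fin.val_castLE, Nat.div_eq_of_lt i.2, Nat.div_eq_of_lt j.2,
    if_true, hi, hj] using this

lemma norm_blockDiagHom (m n : ℕ) [NeZero m] [NeZero n] (h : m ∣ n)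
    (a : Matrix (Fin m) (Fin m) ℂ) : ‖blockDiagHom m n h a‖ = ‖a‖ :=
  NonUnitalStarAlgHom.norm_map _ (blockDiagHom_injective m n h) a

instance (n : ℕ) : NeZero n ! := ⟨Nat.factorial_ne_zero n⟩

/-- The connecting maps `ℂ^{m!×m!} → ℂ^{n!×n!}`, `m ≤ n`, of the inductive system. -/
def conn (m n : ℕ) (h : m ≤ n) :
    Matrix (Fin m !) (Fin m !) ℂ →⋆ₐ[ℂ] Matrix (Fin n !) (Fin n !) ℂ :=
  blockDiagHom (m !) (n !) (Nat.factorial_dvd_factorial h)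

instance : DirectedSystem (fun n : ℕ => Matrix (Fin n !) (Fin n !) ℂ) (conn · · ·) where
  map_self _ a := blockDiagHom_self _ a
  map_map _ _ _ _ _ a := blockDiagHom_comp _ _ _ _ _ a

/-- The algebraic inductive limit of
`ℂ^{1×1} → ℂ^{2×2} → ℂ^{6×6} → ⋯ → ℂ^{n!×n!} → ⋯`. -/
def Algebraic : Type := DirectLimit (fun n => Matrix (Fin n !) (Fin n !) ℂ) conn

namespace Algebraic

instance : Ring Algebraic :=
  inferInstanceAs (Ring (DirectLimit (fun n => Matrix (Fin n !) (Fin n !) ℂ) conn))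

instance : StarRing Algebraic :=
  inferInstanceAs (StarRing (DirectLimit (fun n => Matrix (Fin n !) (Fin n !) ℂ) conn))

instance : Algebra ℂ Algebraic :=
  inferInstanceAs (Algebra ℂ (DirectLimit (fun n => Matrix (Fin n !) (Fin n !) ℂ) conn))

instance : StarModule ℂ Algebraic :=
  inferInstanceAs (StarModule ℂ (DirectLimit (fun n => Matrix (Fin n !) (Fin n !) ℂ) conn))

/-- The canonical map of `ℂ^{n!×n!}` into the inductive limit. -/
def mk (n : ℕ) (a : Matrix (Fin n !) (Fin n !) ℂ) : Algebraic :=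
  (⟦⟨n, a⟩⟧ : DirectLimit (fun n => Matrix (Fin n !) (Fin n !) ℂ) conn)

lemma exists_mk (x : Algebraic) : ∃ n a, x = mk n a := DirectLimit.exists_eq_mk conn x

lemma exists_mk₂ (x y : Algebraic) : ∃ n a b, x = mk n a ∧ y = mk n b :=
  DirectLimit.exists_eq_mk₂ conn x y

lemma mk_add (n : ℕ) (a b : Matrix (Fin n !) (Fin n !) ℂ) : mk n a + mk n b = mk n (a + b) :=
  DirectLimit.add_def (G := fun n : ℕ => Matrix (Fin n !) (Fin n !) ℂ) (f := conn) n a b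

lemma mk_mul (n : ℕ) (a b : Matrix (Fin n !) (Fin n !) ℂ) : mk n a * mk n b = mk n (a * b) :=
  DirectLimit.mul_def (G := fun n : ℕ => Matrix (Fin n !) (Fin n !) ℂ) (f := conn) n a b

lemma mk_neg (n : ℕ) (a : Matrix (Fin n !) (Fin n !) ℂ) : -mk n a = mk n (-a) := rfl

lemma mk_smul (n : ℕ) (c : ℂ) (a : Matrix (Fin n !) (Fin n !) ℂ) : c • mk n a = mk n (c • a) := rfl

lemma mk_star (n : ℕ) (a : Matrix (Fin n !) (Fin n !) ℂ) : star (mk n a) = mk n (star a) := rfl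

lemma mk_zero (n : ℕ) : mk n 0 = 0 := (DirectLimit.zero_def n).symm

/-- The norm of the inductive limit: the operator norm of any representing matrix. -/
def normFun (x : Algebraic) : ℝ :=
  DirectLimit.lift conn (fun _ a => ‖a‖) (fun _ _ _ a => (norm_blockDiagHom _ _ _ a).symm) x

lemma normFun_mk (n : ℕ) (a : Matrix (Fin n !) (Fin n !) ℂ) : normFun (mk n a) = ‖a‖ := rfl

/-- The operator norm on the inductive limit as a ring norm. -/
def ringNorm : RingNorm Algebraic where
  toFun := normFun
  map_zero' := by rw [← mk_zero 0, normFun_mk, norm_zero]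
  add_le' x y := by
    obtain ⟨n, a, b, rfl, rfl⟩ := exists_mk₂ x y
    rw [mk_add]; exact norm_add_le a b
  neg' x := by
    obtain ⟨n, a, rfl⟩ := exists_mk x
    rw [mk_neg]; exact norm_neg a
  mul_le' x y := by
    obtain ⟨n, a, b, rfl, rfl⟩ := exists_mk₂ x y
    rw [mk_mul]; exact norm_mul_le a b
  eq_zero_of_map_eq_zero' x hx := by
    obtain ⟨n, a, rfl⟩ := exists_mk x
    rw [normFun_mk, norm_eq_zero] at hx
    rw [hx, mk_zero]

instance : NormedRing Algebraic := ringNorm.toNormedRing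

lemma norm_mk (n : ℕ) (a : Matrix (Fin n !) (Fin n !) ℂ) : ‖mk n a‖ = ‖a‖ := rfl

instance : NormedAlgebra ℂ Algebraic where
  norm_smul_le c x := by
    obtain ⟨n, a, rfl⟩ := exists_mk x
    rw [mk_smul, norm_mk, norm_mk]; exact norm_smul_le c a

instance : CStarRing Algebraic where
  norm_mul_self_le x := by
    obtain ⟨n, a, rfl⟩ := exists_mk x
    rw [mk_star, mk_mul, norm_mk, norm_mk]; exact CStarRing.norm_mul_self_le a

end Algebraic

/-- The universal UHF algebra `⨂ₙ ℂ^{n×n}`: the `C⋆`-inductive limit of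
`ℂ^{1×1} → ℂ^{2×2} → ℂ^{6×6} → ⋯ → ℂ^{n!×n!} → ⋯`, i.e. the completion of the algebraic one. -/
abbrev Universal : Type := UniformSpace.Completion Algebraic

namespace Universal

open UniformSpace

lemma uniformContinuous_star : UniformContinuous (star : Algebraic → Algebraic) :=
  (starₗᵢ ℂ : Algebraic ≃ₗᵢ⋆[ℂ] Algebraic).isometry.uniformContinuous

instance : Star Universal := ⟨Completion.map star⟩

lemma coe_star (x : Algebraic) : ((star x : Algebraic) : Universal) = star (x : Universal) :=
  (Completion.map_coe uniformContinuous_star x).symm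

lemma continuous_star' : Continuous (star : Universal → Universal) := Completion.continuous_map

instance : StarRing Universal where
  star_involutive x := by
    induction x using Completion.induction_on with
    | hp => exact isClosed_eq (continuous_star'.comp continuous_star') continuous_id
    | ih a => rw [← coe_star, ← coe_star, star_star]
  star_mul x y := by
    induction x, y using Completion.induction_on₂ with
    | hp =>
      exact isClosed_eq (continuous_star'.comp continuous_mul)
        ((continuous_star'.comp continuous_snd).mul (continuous_star'.comp continuous_fst))
    | ih a b => rw [← Completion.coe_mul, ← coe_star, star_mul, Completion.coe_mul, coe_star,
        coe_star]
  star_add x y := by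
    induction x, y using Completion.induction_on₂ with
    | hp =>
      exact isClosed_eq (continuous_star'.comp continuous_add)
        ((continuous_star'.comp continuous_fst).add (continuous_star'.comp continuous_snd))
    | ih a b => rw [← Completion.coe_add, ← coe_star, star_add, Completion.coe_add, coe_star,
        coe_star]

instance : StarModule ℂ Universal where
  star_smul c x := by
    induction x using Completion.induction_on with
    | hp =>
      exact isClosed_eq (continuous_star'.comp (continuous_const_smul c))
        ((continuous_const_smul (star c)).comp continuous_star')
    | ih a => rw [← Completion.coe_smul, ← coe_star, star_smul, Completion.coe_smul, coe_star]

instance : CStarRing Universal where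
  norm_mul_self_le x := by
    induction x using Completion.induction_on with
    | hp =>
      exact isClosed_le (continuous_norm.mul continuous_norm)
        (continuous_norm.comp (continuous_star'.mul continuous_id))
    | ih a =>
      rw [← coe_star, ← Completion.coe_mul, Completion.norm_coe, Completion.norm_coe]
      exact CStarRing.norm_mul_self_le a

instance : NormedAlgebra ℂ Universal where
  norm_smul_le := norm_smul_le

instance : CStarAlgebra Universal where

end Universal

end UHF

end

/-!
For fixed `N` and `M`, cut the torus into the cells of mesh `1 / n`. Multiplication by the
indicator of a cell times an elementary matrix, composed with a translation between two cells,
gives a system of matrix units `FiniteDiff.matUnit` on `L²(𝕋ᴺ → ℂᴹ)`, of size `P = M * n ^ N`. The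
algebras that they span increase with `n` under divisibility, by diagonal blocks once the indices
are enumerated digit by digit (`FiniteDiff.cellEquiv`). A translation by a vector with
denominators dividing `n`, and a step function whose end points have such denominators, lie in the
algebra of mesh `1 / n`; hence the union of these algebras over `n = k!` is dense in the algebra
of finite differential operators.

The sizes `M * (k!) ^ N` and `k!` are cofinal in each other for divisibility. So each
`L²(𝕋ᴺ → ℂᴹ)` carries a representation `FiniteDiff.uhfHom` of the algebraic inductive limit of the
`ℂ^{n!×n!}`, and the closure of its range is the algebra of finite differential operators
(`FiniteDiff.coe_finDiffAlg_eq_closure`). Full matrix algebras are simple, so the representation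
is isometric and extends to an isomorphism from the universal UHF algebra
(`UHF.nonempty_starAlgEquiv`).

For the unitary, let `Ω` be the constant function with value `(1, …, 1) / √M`. It is invariant
under translations and its components are equal, so a matrix unit `e i j` acts on it like `e i i`.
This forces `⟪Ω, ρ(a) Ω⟫` to be `(1 / n!) ∑ a i j` for every `a` in `ℂ^{n!×n!}`
(`FiniteDiff.inner_uhfHom_constVec`), whatever `N` and `M` are. The vector is also cyclic, because
a continuous function is a regulated multiplier applied to `Ω`. By the uniqueness of the GNS
representation (`exists_unitary_intertwining`), the representations for `(1, 1)` and for `(N, M)`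
are unitarily equivalent, and the unitary carries one closure onto the other.
-/

open scoped Matrix.Norms.L2Operator

noncomputable section

/-! ### Matrix units -/

/-- A system of matrix units indexed by `ι` in a unital `⋆`-ring. -/
structure IsMatrixUnits {ι A : Type*} [Fintype ι] [Ring A] [StarRing A] (e : ι → ι → A) :
    Prop where
  mul_eq : ∀ i j l, e i j * e j l = e i l
  mul_ne : ∀ i j k l, j ≠ k → e i j * e k l = 0
  star_eq : ∀ i j, star (e i j) = e j i
  sum_eq : ∑ i, e i i = 1

namespace IsMatrixUnits

variable {ι κ A : Type*} [Fintype ι] [Fintype κ]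

lemma reindex [Ring A] [StarRing A] {e : ι → ι → A} (h : IsMatrixUnits e) (σ : κ ≃ ι) :
    IsMatrixUnits fun i j => e (σ i) (σ j) where
  mul_eq _ _ _ := h.mul_eq _ _ _
  mul_ne _ _ _ _ hjk := h.mul_ne _ _ _ _ (σ.injective.ne hjk)
  star_eq _ _ := h.star_eq _ _
  sum_eq := by rw [← h.sum_eq, ← σ.sum_comp]

variable [DecidableEq ι]

/-- The unital `⋆`-homomorphism `a ↦ ∑ a i j • e i j` given by a system of matrix units. -/
def hom [Ring A] [StarRing A] [Algebra ℂ A] [StarModule ℂ A] {e : ι → ι → A}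
    (h : IsMatrixUnits e) : Matrix ι ι ℂ →⋆ₐ[ℂ] A where
  toFun a := ∑ i, ∑ j, a i j • e i j
  map_one' := by
    rw [← h.sum_eq]
    refine Finset.sum_congr rfl fun i _ => ?_
    rw [Finset.sum_eq_single i] <;> simp +contextual [eq_comm]
  map_mul' a b := by
    simp only [Finset.sum_mul, Matrix.mul_apply, Finset.sum_smul]
    simp only [Finset.mul_sum]
    refine Finset.sum_congr rfl fun i _ => ?_
    have key : ∀ j, ∑ k, ∑ l, (a i j • e i j) * (b k l • e k l)
        = ∑ l, (a i j * b j l) • e i l := fun j => by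
      rw [Finset.sum_eq_single j]
      · simp only [smul_mul_smul_comm, h.mul_eq]
      · intro k _ hk
        simp only [smul_mul_smul_comm, h.mul_ne i j k _ hk.symm, smul_zero, Finset.sum_const_zero]
      · simp
    simp only [key]
    exact Finset.sum_comm
  map_zero' := by simp
  map_add' a b := by simp [add_smul, Finset.sum_add_distrib]
  commutes' r := by
    rw [Algebra.algebraMap_eq_smul_one (R := ℂ) (A := A), ← h.sum_eq, Finset.smul_sum]
    refine Finset.sum_congr rfl fun i _ => ?_
    rw [Finset.sum_eq_single i] <;> simp +contextual [Matrix.algebraMap_matrix_apply, eq_comm]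
  map_star' a := by
    simp only [star_sum, star_smul, h.star_eq, Matrix.star_apply]
    exact Finset.sum_comm

lemma hom_apply [Ring A] [StarRing A] [Algebra ℂ A] [StarModule ℂ A] {e : ι → ι → A}
    (h : IsMatrixUnits e) (a : Matrix ι ι ℂ) : h.hom a = ∑ i, ∑ j, a i j • e i j := rfl

lemma hom_single [Ring A] [StarRing A] [Algebra ℂ A] [StarModule ℂ A] {e : ι → ι → A}
    (h : IsMatrixUnits e) (i j : ι) : h.hom (Matrix.single i j 1) = e i j := by
  rw [hom_apply, Finset.sum_eq_single i, Finset.sum_eq_single j] <;>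
    simp +contextual [Matrix.single_apply, eq_comm]

variable {H : Type*} [NormedAddCommGroup H] [InnerProductSpace ℂ H] [CompleteSpace H]

/-- If `e i j Ω = e i i Ω` for all `i` and `j`, then all the `e i i Ω` have the same norm, so that
the unit vector `Ω` plays the role of `(1, …, 1) / √|ι|`. -/
lemma inner_hom {e : ι → ι → H →L[ℂ] H} (h : IsMatrixUnits e) {Ω : H} (hΩ : ‖Ω‖ = 1)
    (he : ∀ i j, e i j Ω = e i i Ω) (a : Matrix ι ι ℂ) :
    inner ℂ Ω (h.hom a Ω) = (Fintype.card ι : ℂ)⁻¹ * ∑ i, ∑ j, a i j := by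
  -- `⟪Ω, e i j Ω⟫` is symmetric in `i` and `j`, and does not depend on `j`.
  have hsw : ∀ i j, inner ℂ Ω (e i j Ω) = inner ℂ Ω (e j i Ω) := fun i j => by
    have hadj : ∀ i j, ∀ x y : H, inner ℂ (e i j x) y = inner ℂ x (e j i y) := fun i j x y => by
      rw [← h.star_eq i j, ContinuousLinearMap.star_eq_adjoint,
        ContinuousLinearMap.adjoint_inner_right]
    have hc : ∀ i j l, e i j (e j l Ω) = e i l Ω := fun i j l => by
      rw [← h.mul_eq i j l]; rfl
    calc inner ℂ Ω (e i j Ω) = inner ℂ Ω (e i j (e j i Ω)) := by rw [he i j, hc]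
      _ = inner ℂ (e j i Ω) (e j i Ω) := (hadj _ _ _ _).symm
      _ = inner ℂ (e j j Ω) (e j i Ω) := by rw [he j i]
      _ = inner ℂ Ω (e j i Ω) := by rw [hadj, hc]
  have hconst : ∀ i j, inner ℂ Ω (e i i Ω) = inner ℂ Ω (e j j Ω) := fun i j => by
    rw [← he i j, hsw, he]
  have hsum : ∑ i, inner ℂ Ω (e i i Ω) = (1 : ℂ) := by
    rw [← inner_sum, ← sum_apply, h.sum_eq]
    simp [inner_self_eq_norm_sq_to_K, hΩ]
  have hval : ∀ i j, inner ℂ Ω (e i j Ω) = (Fintype.card ι : ℂ)⁻¹ := fun i j => by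
    rw [he]
    simp only [hconst _ i, Finset.sum_const, Finset.card_univ, nsmul_eq_mul] at hsum
    exact eq_inv_of_mul_eq_one_right hsum
  simp only [hom_apply, sum_apply, smul_apply, inner_sum,
    inner_smul_right, hval, Finset.mul_sum]
  exact Finset.sum_congr rfl fun i _ => Finset.sum_congr rfl fun j _ => mul_comm _ _

end IsMatrixUnits

/-! ### Uniqueness of cyclic representations -/

/-- Two cyclic representations of a `⋆`-algebra with the same vector state are unitarily
equivalent. -/
lemma exists_unitary_intertwining {A H K : Type*} [Ring A] [StarRing A] [Algebra ℂ A]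
    [NormedAddCommGroup H] [InnerProductSpace ℂ H] [CompleteSpace H]
    [NormedAddCommGroup K] [InnerProductSpace ℂ K] [CompleteSpace K]
    (ρ : A →⋆ₐ[ℂ] (H →L[ℂ] H)) (τ : A →⋆ₐ[ℂ] (K →L[ℂ] K)) (Ω : H) (Ψ : K)
    (hΩ : DenseRange fun x => ρ x Ω) (hΨ : DenseRange fun x => τ x Ψ)
    (hst : ∀ x, inner ℂ Ω (ρ x Ω) = inner ℂ Ψ (τ x Ψ)) :
    ∃ V : H ≃ₗᵢ[ℂ] K, ∀ x u, V (ρ x u) = τ x (V u) := by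
  let e₁ : A →ₗ[ℂ] H :=
    { toFun := fun x => ρ x Ω, map_add' := by simp, map_smul' := by simp }
  let e₂ : A →ₗ[ℂ] K :=
    { toFun := fun x => τ x Ψ, map_add' := by simp, map_smul' := by simp }
  have h1 : ∀ x, inner ℂ (ρ x Ω) (ρ x Ω) = inner ℂ Ω (ρ (star x * x) Ω) := fun x => by
    rw [map_mul, map_star, ContinuousLinearMap.star_eq_adjoint, mul_apply_eq_comp,
      ContinuousLinearMap.adjoint_inner_right]
  have h2 : ∀ x, inner ℂ (τ x Ψ) (τ x Ψ) = inner ℂ Ψ (τ (star x * x) Ψ) := fun x => by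
    rw [map_mul, map_star, ContinuousLinearMap.star_eq_adjoint, mul_apply_eq_comp,
      ContinuousLinearMap.adjoint_inner_right]
  have hn : ∀ x, ‖e₂ (LinearEquiv.refl ℂ A x)‖ = ‖e₁ x‖ := fun x => by
    change ‖τ x Ψ‖ = ‖ρ x Ω‖
    rw [norm_eq_sqrt_re_inner (𝕜 := ℂ), norm_eq_sqrt_re_inner (𝕜 := ℂ), h1, h2, hst]
  let V := (LinearEquiv.refl ℂ A).extendOfIsometry e₁ e₂ hΩ hΨ hn
  have hV : ∀ x, V (ρ x Ω) = τ x Ψ := fun x =>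
    LinearEquiv.extendOfIsometry_eq (LinearEquiv.refl ℂ A) e₁ e₂ hΩ hΨ hn x
  refine ⟨V, fun x u => ?_⟩
  refine hΩ.induction_on (p := fun u => V (ρ x u) = τ x (V u)) u ?_ fun y => ?_
  · exact isClosed_eq (V.continuous.comp (ρ x).continuous) ((τ x).continuous.comp V.continuous)
  · have hx : ρ x (ρ y Ω) = ρ (x * y) Ω := by rw [map_mul]; rfl
    rw [hx, hV, hV, map_mul]; rfl

/-! ### Representations of the universal UHF algebra -/

namespace UHF

open scoped Nat

/-- The bijection `(c, k) ↦ k + m * c`. It decomposes an index of `ℂ^{n×n}`, `n = m * q`, into the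
number `c` of a diagonal block and a position `k` in that block. -/
def blockEquiv {m q n : ℕ} (h : m * q = n) : Fin q × Fin m ≃ Fin n :=
  finProdFinEquiv.trans (finCongr (by rw [← h, mul_comm]))

lemma blockDiagHom_blockEquiv {m q n : ℕ} [NeZero m] (h : m * q = n) (hd : m ∣ n)
    (a : Matrix (Fin m) (Fin m) ℂ) (c d : Fin q) (k l : Fin m) :
    blockDiagHom m n hd a (blockEquiv h (c, k)) (blockEquiv h (d, l)) =
      if c = d then a k l else 0 := by
  have hm : 0 < m := Nat.pos_of_ne_zero (NeZero.ne m)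
  have he : ∀ c k, ((blockEquiv h (c, k) : Fin n) : ℕ) = k + m * c := fun c k => rfl
  have hdiv : ∀ c k, ((blockEquiv h (c, k) : Fin n) : ℕ) / m = c := fun c k => by
    rw [he, Nat.add_mul_div_left _ _ hm, Nat.div_eq_of_lt k.2, zero_add]
  have hmod : ∀ c k, Fin.ofNat m ((blockEquiv h (c, k) : Fin n) : ℕ) = k := fun c k => by
    apply Fin.ext
    simp only [Fin.val_ofNat]
    rw [he, Nat.add_mul_mod_self_left, Nat.mod_eq_of_lt k.2]
  rw [blockDiagHom_apply, hdiv, hdiv, hmod, hmod]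
  simp only [Fin.val_inj]

lemma sum_blockDiagHom {m q n : ℕ} [NeZero m] (h : m * q = n) (hd : m ∣ n)
    (a : Matrix (Fin m) (Fin m) ℂ) :
    ∑ i, ∑ j, blockDiagHom m n hd a i j = q * ∑ i, ∑ j, a i j := by
  rw [← (blockEquiv h).sum_comp, Fintype.sum_prod_type]
  simp_rw [← (blockEquiv h).sum_comp, Fintype.sum_prod_type, blockDiagHom_blockEquiv]
  have : ∀ (c : Fin q) (k : Fin m), ∑ d : Fin q, ∑ l, (if c = d then a k l else 0)
      = ∑ l, a k l := fun c k => by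
    rw [Finset.sum_eq_single c] <;> simp +contextual [eq_comm]
  calc _ = ∑ c : Fin q, ∑ k, ∑ l, a k l :=
        Finset.sum_congr rfl fun c _ => Finset.sum_congr rfl fun k _ => this c k
    _ = _ := by simp

/-- If the matrix units `e i j` are obtained from the matrix units `f` by summation over the
diagonal blocks, then the two representations are compatible with `a ↦ diag(a, …, a)`. -/
lemma hom_blockDiagHom {A : Type*} [Ring A] [StarRing A] [Algebra ℂ A] [StarModule ℂ A]
    {m q n : ℕ} [NeZero m] (h : m * q = n) (hd : m ∣ n) {e : Fin m → Fin m → A}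
    {f : Fin n → Fin n → A} (he : IsMatrixUnits e) (hf : IsMatrixUnits f)
    (hef : ∀ i j, e i j = ∑ c, f (blockEquiv h (c, i)) (blockEquiv h (c, j)))
    (a : Matrix (Fin m) (Fin m) ℂ) : hf.hom (blockDiagHom m n hd a) = he.hom a := by
  rw [IsMatrixUnits.hom_apply, IsMatrixUnits.hom_apply, ← (blockEquiv h).sum_comp,
    Fintype.sum_prod_type_right]
  refine Finset.sum_congr rfl fun i _ => ?_
  simp_rw [← (blockEquiv h).sum_comp, Fintype.sum_prod_type, blockDiagHom_blockEquiv]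
  have : ∀ c : Fin q, ∑ d : Fin q, ∑ j, (if c = d then a i j else 0) •
      f (blockEquiv h (c, i)) (blockEquiv h (d, j)) =
      ∑ j, a i j • f (blockEquiv h (c, i)) (blockEquiv h (c, j)) := fun c => by
    rw [Finset.sum_eq_single c]
    · simp
    · intro d _ hd
      simp [hd.symm]
    · simp
  simp_rw [this, hef, Finset.smul_sum]
  exact Finset.sum_comm

section Lift

variable {A : Type*} [Ring A] [StarRing A] [Algebra ℂ A]

/-- The `⋆`-homomorphism out of the algebraic inductive limit given by a compatible family. -/
def Algebraic.lift (π : ∀ n : ℕ, Matrix (Fin n !) (Fin n !) ℂ →⋆ₐ[ℂ] A)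
    (hπ : ∀ m n h a, π n (conn m n h a) = π m a) : Algebraic →⋆ₐ[ℂ] A where
  toFun := DirectLimit.lift conn (fun n a => π n a) fun m n h a => (hπ m n h a).symm
  map_one' := DirectLimit.lift_one (f := conn) π _
  map_mul' x y := DirectLimit.lift_mul (f := conn) π _ x y
  map_zero' := by
    rw [← Algebraic.mk_zero 0]
    exact map_zero (π 0)
  map_add' x y := by
    obtain ⟨n, a, b, rfl, rfl⟩ := Algebraic.exists_mk₂ x y
    rw [Algebraic.mk_add]
    exact map_add (π n) a b
  commutes' r := by
    rw [Algebra.algebraMap_eq_smul_one, Algebra.algebraMap_eq_smul_one]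
    have h1 : (1 : Algebraic) = Algebraic.mk 0 1 := DirectLimit.one_def (f := conn) 0
    rw [h1, Algebraic.mk_smul]
    exact (map_smul (π 0) r 1).trans (by rw [map_one])
  map_star' x := by
    obtain ⟨n, a, rfl⟩ := Algebraic.exists_mk x
    rw [Algebraic.mk_star]
    exact map_star (π n) a

end Lift

/-- Full matrix algebras are simple, so that every representation of the algebraic inductive limit
in a nonzero `C⋆`-algebra is isometric. -/
lemma Algebraic.norm_map {A : Type*} [CStarAlgebra A] [Nontrivial A] (ρ : Algebraic →⋆ₐ[ℂ] A)
    (x : Algebraic) : ‖ρ x‖ = ‖x‖ := by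
  obtain ⟨n, a, rfl⟩ := Algebraic.exists_mk x
  let ψ : Matrix (Fin n !) (Fin n !) ℂ →⋆ₐ[ℂ] A :=
    { toFun := fun a => ρ (Algebraic.mk n a)
      map_one' := by
        have h1 : (1 : Algebraic) = Algebraic.mk n 1 := DirectLimit.one_def (f := conn) n
        rw [← h1, map_one]
      map_mul' := fun a b => by rw [← Algebraic.mk_mul, map_mul]
      map_zero' := by rw [Algebraic.mk_zero, map_zero]
      map_add' := fun a b => by rw [← Algebraic.mk_add, map_add]
      commutes' := fun r => by
        have h1 : (1 : Algebraic) = Algebraic.mk n 1 := DirectLimit.one_def (f := conn) n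
        rw [Algebra.algebraMap_eq_smul_one, ← Algebraic.mk_smul, ← h1, map_smul, map_one,
          Algebra.algebraMap_eq_smul_one]
      map_star' := fun a => by rw [← Algebraic.mk_star, map_star] }
  -- `RingHom.injective` applies since a full matrix algebra is a simple ring.
  have hψ : Function.Injective ψ := ψ.toAlgHom.toRingHom.injective
  exact NonUnitalStarAlgHom.norm_map ψ hψ a

/-- The universal UHF algebra is the closure of the range of any representation of the algebraic
inductive limit. -/
lemma nonempty_starAlgEquiv {A : Type*} [CStarAlgebra A] [Nontrivial A] (ρ : Algebraic →⋆ₐ[ℂ] A)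
    (S : StarSubalgebra ℂ A) (hS : (S : Set A) = closure (Set.range ρ)) :
    Nonempty (S ≃⋆ₐ[ℂ] Universal) := by
  have hiso : Isometry ρ := AddMonoidHomClass.isometry_of_norm ρ (Algebraic.norm_map ρ)
  let g : Universal →+* A := UniformSpace.Completion.extensionHom
    (ρ.toAlgHom.toRingHom : Algebraic →+* A) hiso.continuous
  have hg : ∀ x : Algebraic, g (x : Universal) = ρ x := fun x =>
    UniformSpace.Completion.extensionHom_coe _ hiso.continuous x
  have hgiso : Isometry g := hiso.completion_extension
  have hgsmul : ∀ (r : ℂ) (x : Universal), g (r • x) = r • g x := fun r x => by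
    induction x using UniformSpace.Completion.induction_on with
    | hp =>
      exact isClosed_eq (hgiso.continuous.comp (continuous_const_smul r))
        ((continuous_const_smul r).comp hgiso.continuous)
    | ih a => rw [← UniformSpace.Completion.coe_smul, hg, hg, map_smul]
  have hgstar : ∀ x : Universal, g (star x) = star (g x) := fun x => by
    induction x using UniformSpace.Completion.induction_on with
    | hp =>
      exact isClosed_eq (hgiso.continuous.comp Universal.continuous_star')
        (continuous_star.comp hgiso.continuous)
    | ih a => rw [← Universal.coe_star, hg, hg, map_star]
  have hrange : Set.range g = S := by
    rw [hS]
    apply Set.Subset.antisymm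
    · rintro _ ⟨x, rfl⟩
      induction x using UniformSpace.Completion.induction_on with
      | hp => exact isClosed_closure.preimage hgiso.continuous
      | ih a => rw [hg]; exact subset_closure ⟨a, rfl⟩
    · refine closure_minimal ?_ hgiso.isClosedEmbedding.isClosed_range
      rintro _ ⟨a, rfl⟩
      exact ⟨a, hg a⟩
  let f : Universal →⋆ₐ[ℂ] S :=
    { toFun := fun x => ⟨g x, by rw [← SetLike.mem_coe, ← hrange]; exact ⟨x, rfl⟩⟩
      map_one' := Subtype.ext (map_one g)
      map_mul' := fun x y => Subtype.ext (map_mul g x y)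
      map_zero' := Subtype.ext (map_zero g)
      map_add' := fun x y => Subtype.ext (map_add g x y)
      commutes' := fun r => Subtype.ext <| by
        change g (algebraMap ℂ Universal r) = algebraMap ℂ A r
        rw [Algebra.algebraMap_eq_smul_one, hgsmul, map_one, Algebra.algebraMap_eq_smul_one]
      map_star' := fun x => Subtype.ext (hgstar x) }
  have hf : Function.Bijective f := by
    refine ⟨fun x y hxy => hgiso.injective (congrArg Subtype.val hxy), fun y => ?_⟩
    have hy : (y : A) ∈ Set.range g := by rw [hrange]; exact y.2
    obtain ⟨x, hx⟩ := hy
    exact ⟨x, Subtype.ext hx⟩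
  exact ⟨(StarAlgEquiv.ofBijective f hf).symm⟩

end UHF

namespace FiniteDiff

open MeasureTheory

/-! ### The grid of mesh `1 / n` on the circle -/

section Circle

variable {n : ℕ}

/-- The index of the arc `[c / n, (c + 1) / n)`, `0 ≤ c < n`, that contains a given point. -/
def arcIdx (n : ℕ) [NeZero n] : UnitAddCircle → Fin n :=
  Function.Periodic.lift (f := fun t : ℝ => Fin.ofNat n (⌊n * t⌋ % n).toNat) (c := 1) <| by
    intro t
    have : (n : ℝ) * (t + 1) = n * t + (n : ℤ) := by push_cast; ring
    simp only [this, Int.floor_add_intCast, Int.add_emod_right]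

/-- The point `z / n` of the circle. -/
def gridPt (n : ℕ) (z : ℤ) : UnitAddCircle := ((z / n : ℝ) : UnitAddCircle)

lemma gridPt_sub (z w : ℤ) : gridPt n z - gridPt n w = gridPt n (z - w) := by
  simp only [gridPt, ← AddCircle.coe_sub]
  congr 1
  push_cast
  ring

lemma coe_arcIdx [NeZero n] (t : ℝ) :
    ((arcIdx n (t : UnitAddCircle) : ℕ) : ℤ) = ⌊n * t⌋ % n := by
  have hn : (0 : ℤ) < n := by exact_mod_cast Nat.pos_of_ne_zero (NeZero.ne n)
  have h0 := Int.emod_nonneg ⌊n * t⌋ hn.ne'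
  have h1 := Int.emod_lt_of_pos ⌊n * t⌋ hn
  have : arcIdx n (t : UnitAddCircle) = Fin.ofNat n (⌊n * t⌋ % n).toNat := rfl
  rw [this, Fin.val_ofNat, Nat.mod_eq_of_lt (by omega), Int.toNat_of_nonneg h0]

lemma coe_eq_coe_iff_exists_int (s t : ℝ) :
    (s : UnitAddCircle) = t ↔ ∃ m : ℤ, s = t + m := by
  rw [← sub_eq_zero, ← AddCircle.coe_sub, AddCircle.coe_eq_zero_iff]
  refine exists_congr fun m => ?_
  simp only [zsmul_eq_mul, mul_one]
  constructor <;> intro h <;> linarith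

lemma coe_mem_arc [NeZero n] (a b : ℤ) (t : ℝ) :
    (t : UnitAddCircle) ∈ arc (a / n) (b / n) ↔
      ∃ m : ℤ, a ≤ ⌊n * t⌋ + n * m ∧ ⌊n * t⌋ + n * m < b := by
  have hn : (0 : ℝ) < n := by exact_mod_cast Nat.pos_of_ne_zero (NeZero.ne n)
  have hf : ∀ m : ℤ, ⌊n * t⌋ + n * m = ⌊n * (t + m)⌋ := fun m => by
    have : (n : ℝ) * (t + m) = n * t + ((n * m : ℤ) : ℝ) := by push_cast; ring
    rw [this, Int.floor_add_intCast]
  have key : ∀ s : ℝ, s ∈ Set.Ico (((a / n : ℚ)) : ℝ) ((b / n : ℚ) : ℝ) ↔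
      a ≤ ⌊n * s⌋ ∧ ⌊n * s⌋ < b := fun s => by
    rw [Int.le_floor, Int.floor_lt, Set.mem_Ico]
    push_cast
    rw [div_le_iff₀ hn, lt_div_iff₀ hn, mul_comm s]
  constructor
  · rintro ⟨s, hs, hst⟩
    obtain ⟨m, rfl⟩ := (coe_eq_coe_iff_exists_int s t).1 hst
    exact ⟨m, by rw [hf]; exact (key _).1 hs⟩
  · rintro ⟨m, hm⟩
    rw [hf] at hm
    exact ⟨t + m, (key _).2 hm, (coe_eq_coe_iff_exists_int _ _).2 ⟨m, rfl⟩⟩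

lemma natCast_mul_div_self [NeZero n] (z : ℤ) : ⌊(n : ℝ) * (z / n : ℝ)⌋ = z := by
  have hn : (n : ℝ) ≠ 0 := by exact_mod_cast NeZero.ne n
  rw [mul_div_cancel₀ _ hn, Int.floor_intCast]

/-- Membership in an arc with end points on the grid depends only on the cell of a point. -/
lemma gridPt_arcIdx_mem_arc [NeZero n] (a b : ℤ) (x : UnitAddCircle) :
    gridPt n (arcIdx n x : ℕ) ∈ arc (a / n) (b / n) ↔ x ∈ arc (a / n) (b / n) := by
  induction x using QuotientAddGroup.induction_on with | H t => ?_
  have hd := Int.emod_add_mul_ediv ⌊n * t⌋ n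
  refine (coe_mem_arc a b _).trans (Iff.trans ?_ (coe_mem_arc a b t).symm)
  rw [natCast_mul_div_self]
  rw [show ((arcIdx n (QuotientAddGroup.mk t : UnitAddCircle) : ℕ) : ℤ) = ⌊n * t⌋ % n from
    coe_arcIdx t]
  constructor
  · rintro ⟨m, hm⟩
    refine ⟨m - ⌊n * t⌋ / n, ?_⟩
    rw [mul_sub]
    constructor <;> linarith [hm.1, hm.2]
  · rintro ⟨m, hm⟩
    refine ⟨m + ⌊n * t⌋ / n, ?_⟩
    rw [mul_add]
    constructor <;> linarith [hm.1, hm.2]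

lemma mem_arc_iff_arcIdx_eq [NeZero n] (c : Fin n) (x : UnitAddCircle) :
    x ∈ arc (((c : ℕ) : ℤ) / n) ((((c : ℕ) : ℤ) + 1 : ℤ) / n) ↔ arcIdx n x = c := by
  rw [← gridPt_arcIdx_mem_arc]
  refine (coe_mem_arc _ _ _).trans ?_
  rw [natCast_mul_div_self, Fin.ext_iff]
  have h1 := (arcIdx n x).2
  have h2 := c.2
  constructor
  · rintro ⟨m, hm1, hm2⟩
    have hm : m = 0 := by
      have hn : (0 : ℤ) < n := by omega
      have h3 : (n : ℤ) * m < n * 1 := by omega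
      have h4 : (n : ℤ) * (-1) < n * m := by omega
      have := lt_of_mul_lt_mul_left h3 hn.le
      have := lt_of_mul_lt_mul_left h4 hn.le
      omega
    subst hm
    omega
  · intro h
    exact ⟨0, by omega, by omega⟩

lemma arcIdx_add_gridPt [NeZero n] (i j : Fin n) (x : UnitAddCircle) :
    arcIdx n (x + (gridPt n (j : ℕ) - gridPt n (i : ℕ))) = j ↔ arcIdx n x = i := by
  induction x using QuotientAddGroup.induction_on with | H t => ?_
  have hn : (n : ℝ) ≠ 0 := by exact_mod_cast NeZero.ne n
  have hn' : (n : ℤ) ≠ 0 := by exact_mod_cast NeZero.ne n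
  have e : (QuotientAddGroup.mk t : UnitAddCircle) + (gridPt n (j : ℕ) - gridPt n (i : ℕ)) =
      ((t + ((((j : ℕ) : ℤ) - ((i : ℕ) : ℤ) : ℤ) : ℝ) / n : ℝ) : UnitAddCircle) := by
    rw [gridPt_sub, AddCircle.coe_add]; rfl
  have e2 : (n : ℝ) * (t + ((((j : ℕ) : ℤ) - ((i : ℕ) : ℤ) : ℤ) : ℝ) / n) =
      n * t + ((((j : ℕ) : ℤ) - ((i : ℕ) : ℤ) : ℤ) : ℝ) := by field_simp
  rw [e, Fin.ext_iff, Fin.ext_iff, ← Nat.cast_inj (R := ℤ), ← Nat.cast_inj (R := ℤ), coe_arcIdx,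
    show ((arcIdx n (QuotientAddGroup.mk t : UnitAddCircle) : ℕ) : ℤ) = ⌊n * t⌋ % n from
    coe_arcIdx t, e2, Int.floor_add_intCast]
  have hi : ((i : ℕ) : ℤ) % n = (i : ℕ) := Int.emod_eq_of_lt (by omega) (by exact_mod_cast i.2)
  have hj : ((j : ℕ) : ℤ) % n = (j : ℕ) := Int.emod_eq_of_lt (by omega) (by exact_mod_cast j.2)
  have key := Int.emod_add_cancel_right (m := ⌊(n : ℝ) * t⌋) (n := n) (k := (i : ℕ))
    (((j : ℕ) : ℤ) - ((i : ℕ) : ℤ))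
  rwa [add_sub_cancel, hi, hj] at key

/-- Refining the mesh by a factor `r` splits the cell `c` into the cells `r * c + d`, `d < r`. -/
lemma arcIdx_div [NeZero n] {m r : ℕ} [NeZero m] (h : n = m * r) (x : UnitAddCircle) :
    (arcIdx m x : ℕ) = (arcIdx n x : ℕ) / r := by
  induction x using QuotientAddGroup.induction_on with | H t => ?_
  subst h
  have hr : 0 < r := Nat.pos_of_ne_zero fun h => NeZero.ne (m * r) (by simp [h])
  have hm : 0 < m := Nat.pos_of_ne_zero (NeZero.ne m)
  have hr' : (r : ℝ) ≠ 0 := by exact_mod_cast hr.ne'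
  have e : (m : ℝ) * t = ((m * r : ℕ) : ℝ) * t / (r : ℕ) := by push_cast; field_simp
  have hmod : ∀ z : ℤ, z / r % m = z % (m * r : ℕ) / r := fun z => by
    have hr0 : (r : ℤ) ≠ 0 := by exact_mod_cast hr.ne'
    have h1 : z / r = z % (m * r : ℕ) / r + m * (z / (m * r : ℕ)) := by
      conv_lhs => rw [← Int.emod_add_mul_ediv z (m * r : ℕ)]
      rw [← Int.add_mul_ediv_right _ _ hr0]
      congr 1
      push_cast
      ring
    have h2 := Int.emod_nonneg z (b := ((m * r : ℕ) : ℤ)) (by exact_mod_cast NeZero.ne (m * r))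
    have h3 := Int.emod_lt_of_pos z (b := ((m * r : ℕ) : ℤ))
      (by exact_mod_cast Nat.mul_pos hm hr)
    rw [h1, Int.add_mul_emod_self_left]
    refine Int.emod_eq_of_lt (Int.ediv_nonneg h2 (by positivity)) ?_
    exact Int.ediv_lt_of_lt_mul (by exact_mod_cast hr) (by exact_mod_cast h3)
  rw [← Nat.cast_inj (R := ℤ), Int.natCast_div]
  refine (coe_arcIdx t).trans (Eq.trans ?_ (congrArg (· / (r : ℤ)) (coe_arcIdx t)).symm)
  rw [e, Int.floor_div_natCast, hmod]

lemma exists_gridPt_eq [NeZero n] (z : ℤ) : ∃ c : Fin n, gridPt n (c : ℕ) = gridPt n z := by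
  have hn : (n : ℝ) ≠ 0 := by exact_mod_cast NeZero.ne n
  refine ⟨arcIdx n (gridPt n z), ?_⟩
  rw [gridPt, gridPt, coe_eq_coe_iff_exists_int, coe_arcIdx, natCast_mul_div_self]
  refine ⟨-(z / n), ?_⟩
  have hd : (z : ℝ) = ((z % n + n * (z / n) : ℤ) : ℝ) := by rw [Int.emod_add_mul_ediv]
  field_simp
  push_cast at hd ⊢
  linarith

lemma dist_gridPt_arcIdx_le [NeZero n] (x : UnitAddCircle) :
    dist x (gridPt n (arcIdx n x : ℕ)) ≤ 1 / n := by
  induction x using QuotientAddGroup.induction_on with | H t => ?_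
  have hn : (0 : ℝ) < n := by exact_mod_cast Nat.pos_of_ne_zero (NeZero.ne n)
  have e : gridPt n (arcIdx n (QuotientAddGroup.mk t : UnitAddCircle) : ℕ) =
      ((⌊n * t⌋ / n : ℝ) : UnitAddCircle) := by
    rw [gridPt, coe_eq_coe_iff_exists_int,
      show ((arcIdx n (QuotientAddGroup.mk t : UnitAddCircle) : ℕ) : ℤ) = ⌊n * t⌋ % n from
        coe_arcIdx t]
    refine ⟨-(⌊n * t⌋ / n), ?_⟩
    have hd : ((⌊n * t⌋ : ℤ) : ℝ) = ((⌊n * t⌋ % n + n * (⌊n * t⌋ / n) : ℤ) : ℝ) := by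
      rw [Int.emod_add_mul_ediv]
    field_simp
    push_cast at hd ⊢
    linarith
  rw [e, dist_eq_norm]
  change ‖((t : ℝ) : UnitAddCircle) - _‖ ≤ _
  rw [← AddCircle.coe_sub]
  refine (QuotientAddGroup.norm_mk_le_norm).trans ?_
  have h1 := Int.floor_le (n * t)
  have h2 := Int.lt_floor_add_one (n * t)
  have h3 : t - ⌊n * t⌋ / n = (n * t - ⌊n * t⌋) / n := by field_simp
  rw [h3, Real.norm_eq_abs, abs_of_nonneg (div_nonneg (by linarith) hn.le)]
  exact div_le_div_of_nonneg_right (by linarith) hn.le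

end Circle

variable {N M : ℕ}

/-! ### Multiplication operators -/

lemma norm_toEuclideanCLM_apply_le (A : Matrix (Fin M) (Fin M) ℂ)
    (v : EuclideanSpace ℂ (Fin M)) :
    ‖Matrix.toEuclideanCLM (n := Fin M) (𝕜 := ℂ) A v‖ ≤ ‖A‖ * ‖v‖ :=
  (Matrix.toEuclideanCLM (n := Fin M) (𝕜 := ℂ) A).le_opNorm v

section MulOp

variable {S T R : Torus N → Matrix (Fin M) (Fin M) ℂ}

lemma mulOp_mul (hS : S ∈ Regulated N M) (hT : T ∈ Regulated N M) (hR : R ∈ Regulated N M)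
    (h : ∀ x, R x = S x * T x) : mulOp S hS * mulOp T hT = mulOp R hR := by
  ext1 u
  apply Lp.ext
  filter_upwards [coeFn_mulOp S hS (mulOp T hT u), coeFn_mulOp T hT u, coeFn_mulOp R hR u]
    with x h1 h2 h3
  rw [mul_apply_eq_comp, h1, h2, h3, h, map_mul, mul_apply_eq_comp]

lemma mulOp_add (hS : S ∈ Regulated N M) (hT : T ∈ Regulated N M) (hR : R ∈ Regulated N M)
    (h : ∀ x, R x = S x + T x) : mulOp S hS + mulOp T hT = mulOp R hR := by
  ext1 u
  apply Lp.ext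
  rw [add_apply]
  filter_upwards [coeFn_mulOp S hS u, coeFn_mulOp T hT u, coeFn_mulOp R hR u,
    Lp.coeFn_add (mulOp S hS u) (mulOp T hT u)] with x h1 h2 h3 h4
  rw [h4, Pi.add_apply, h1, h2, h3, h, map_add, add_apply]

lemma mulOp_algebraMap (r : ℂ) (hR : R ∈ Regulated N M)
    (h : ∀ x, R x = algebraMap ℂ _ r) : mulOp R hR = algebraMap ℂ _ r := by
  ext1 u
  apply Lp.ext
  rw [Algebra.algebraMap_eq_smul_one]
  refine Filter.EventuallyEq.trans ?_ (Lp.coeFn_smul r u).symm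
  filter_upwards [coeFn_mulOp R hR u] with x h1
  rw [h1, h, Algebra.algebraMap_eq_smul_one, map_smul, map_one]
  rfl

lemma norm_mulOp_sub_le (hS : S ∈ Regulated N M) (hT : T ∈ Regulated N M) {ε : ℝ} (hε : 0 ≤ ε)
    (h : ∀ x, ‖S x - T x‖ ≤ ε) : ‖mulOp S hS - mulOp T hT‖ ≤ ε := by
  refine ContinuousLinearMap.opNorm_le_bound _ hε fun u => ?_
  refine Lp.norm_le_mul_norm_of_ae_le_mul ?_
  rw [sub_apply]
  filter_upwards [coeFn_mulOp S hS u, coeFn_mulOp T hT u,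
    Lp.coeFn_sub (mulOp S hS u) (mulOp T hT u)] with x h1 h2 h3
  rw [h3, Pi.sub_apply, h1, h2, ← sub_apply, ← map_sub]
  exact (norm_toEuclideanCLM_apply_le _ _).trans
    (mul_le_mul_of_nonneg_right (h x) (norm_nonneg _))

end MulOp

/-! ### Translations -/

/-- The translation operator `u(x) ↦ u(x + t)` for a vector `t` of the torus. -/
def shiftVec (t : Torus N) : L2 N M →L[ℂ] L2 N M :=
  (Lp.compMeasurePreservingₗᵢ ℂ (fun x : Torus N => x + t)
    (measurePreserving_add_right volume t)).toContinuousLinearMap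

lemma coeFn_shiftVec (t : Torus N) (u : L2 N M) :
    ⇑(shiftVec t u) =ᵐ[volume] fun x => u (x + t) :=
  Lp.coeFn_compMeasurePreserving u (measurePreserving_add_right volume t)

lemma norm_shiftVec_apply (t : Torus N) (u : L2 N M) : ‖shiftVec t u‖ = ‖u‖ :=
  LinearIsometry.norm_map _ u

lemma shiftOp_eq_shiftVec (i : Fin N) (h : ℚ) :
    (shiftOp i h : L2 N M →L[ℂ] L2 N M) = shiftVec (Pi.single i ((h : ℝ) : UnitAddCircle)) := rfl

/-- Almost everywhere statements are invariant under translation. -/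
lemma ae_add {p : Torus N → Prop} (t : Torus N) (h : ∀ᵐ x, p x) : ∀ᵐ x, p (x + t) :=
  (measurePreserving_add_right (volume : Measure (Torus N)) t).quasiMeasurePreserving.ae h

lemma shiftVec_mul (s t : Torus N) :
    (shiftVec s * shiftVec t : L2 N M →L[ℂ] L2 N M) = shiftVec (s + t) := by
  ext1 u
  apply Lp.ext
  filter_upwards [coeFn_shiftVec s (shiftVec t u), ae_add s (coeFn_shiftVec t u),
    coeFn_shiftVec (s + t) u] with x h1 h2 h3
  rw [mul_apply_eq_comp, h1, h2, h3, add_assoc]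

lemma shiftVec_zero : (shiftVec 0 : L2 N M →L[ℂ] L2 N M) = 1 := by
  ext1 u
  apply Lp.ext
  filter_upwards [coeFn_shiftVec 0 u] with x h1
  rw [h1, add_zero]
  rfl

lemma star_shiftVec (t : Torus N) :
    star (shiftVec t : L2 N M →L[ℂ] L2 N M) = shiftVec (-t) := by
  have key : (shiftVec t * shiftVec (-t) : L2 N M →L[ℂ] L2 N M) = 1 := by
    rw [shiftVec_mul, add_neg_cancel, shiftVec_zero]
  have hiso : star (shiftVec t : L2 N M →L[ℂ] L2 N M) * shiftVec t = 1 :=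
    (ContinuousLinearMap.norm_map_iff_adjoint_comp_self _).1 (norm_shiftVec_apply t)
  calc star (shiftVec t : L2 N M →L[ℂ] L2 N M)
      = star (shiftVec t) * (shiftVec t * shiftVec (-t)) := by rw [key, mul_one]
    _ = shiftVec (-t) := by rw [← mul_assoc, hiso, one_mul]

lemma shiftVec_mul_mulOp {S T : Torus N → Matrix (Fin M) (Fin M) ℂ} (t : Torus N)
    (hS : S ∈ Regulated N M) (hT : T ∈ Regulated N M) (h : ∀ x, T x = S (x + t)) :
    shiftVec t * mulOp S hS = mulOp T hT * shiftVec t := by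
  ext1 u
  apply Lp.ext
  filter_upwards [coeFn_shiftVec t (mulOp S hS u), ae_add t (coeFn_mulOp S hS u),
    coeFn_mulOp T hT (shiftVec t u), coeFn_shiftVec t u] with x h1 h2 h3 h4
  rw [mul_apply_eq_comp, mul_apply_eq_comp, h1, h2, h3, h4, h]

/-! ### Grids on the torus -/

section Grid

variable (n : ℕ) [NeZero n]

/-- The cell of mesh `1 / n` that contains a given point of the torus. The index `c` stands for the
cube `∏ i, [c i / n, (c i + 1) / n)`. -/
def cellIdx (x : Torus N) : Fin N → Fin n := fun i => arcIdx n (x i)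

/-- The corner `c / n` of the cell with index `c`. -/
def corner (c : Fin N → Fin n) : Torus N := fun i => gridPt n (c i : ℕ)

variable {n}

lemma cellIdx_add_corner (i j : Fin N → Fin n) (x : Torus N) :
    cellIdx n (x + (corner n j - corner n i)) = j ↔ cellIdx n x = i := by
  simp only [funext_iff]
  exact forall_congr' fun k => arcIdx_add_gridPt (i k) (j k) (x k)

lemma mem_box_iff_cellIdx_eq (c : Fin N → Fin n) (x : Torus N) :
    x ∈ box (fun i => (((c i : ℕ) : ℤ) : ℚ) / n) (fun i => ((((c i : ℕ) : ℤ) + 1 : ℤ) : ℚ) / n) ↔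
      cellIdx n x = c := by
  simp only [box, Set.mem_univ_pi, funext_iff]
  exact forall_congr' fun i => mem_arc_iff_arcIdx_eq (c i) (x i)

/-- Functions that are constant on the cells of a grid are regulated. -/
lemma comp_cellIdx_mem_regulated (F : (Fin N → Fin n) → Matrix (Fin M) (Fin M) ℂ) :
    (fun x => F (cellIdx n x)) ∈ Regulated N M := by
  intro ε hε
  let e := (Fintype.equivFin (Fin N → Fin n)).symm
  refine ⟨_, fun k i => (((e k i : ℕ) : ℤ) : ℚ) / n,
    fun k i => ((((e k i : ℕ) : ℤ) + 1 : ℤ) : ℚ) / n, fun k => F (e k), fun x => ?_⟩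
  have : stepFun (fun k i => (((e k i : ℕ) : ℤ) : ℚ) / n)
      (fun k i => ((((e k i : ℕ) : ℤ) + 1 : ℤ) : ℚ) / n) (fun k => F (e k)) x =
      F (cellIdx n x) := by
    rw [stepFun, Finset.sum_eq_single (e.symm (cellIdx n x))]
    · rw [Set.indicator_of_mem]
      · simp
      · rw [mem_box_iff_cellIdx_eq]; simp
    · intro k _ hk
      rw [Set.indicator_of_notMem]
      rw [mem_box_iff_cellIdx_eq]
      rintro h
      exact hk (by rw [h]; simp)
    · simp
  rw [this, sub_self, norm_zero]
  exact hε.le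

variable (M n) in
/-- The operators of multiplication by functions that are constant on the cells of the grid of
mesh `1 / n`, as a representation of the algebra of matrix-valued functions of the cell. -/
def gridHom : ((Fin N → Fin n) → Matrix (Fin M) (Fin M) ℂ) →⋆ₐ[ℂ] (L2 N M →L[ℂ] L2 N M) where
  toFun F := mulOp (fun x => F (cellIdx n x)) (comp_cellIdx_mem_regulated F)
  map_one' := (mulOp_algebraMap 1 _ fun _ => (map_one _).symm).trans (map_one _)
  map_mul' _ _ := (mulOp_mul _ _ _ fun _ => rfl).symm
  map_zero' := (mulOp_algebraMap 0 _ fun _ => (map_zero _).symm).trans (map_zero _)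
  map_add' _ _ := (mulOp_add _ _ _ fun _ => rfl).symm
  commutes' r := mulOp_algebraMap r _ fun _ => rfl
  map_star' _ := (star_mulOp _ _).symm

lemma gridHom_apply (F : (Fin N → Fin n) → Matrix (Fin M) (Fin M) ℂ) :
    gridHom M n F = mulOp (fun x => F (cellIdx n x)) (comp_cellIdx_mem_regulated F) := rfl

/-- Moving the multiplier on the cell `j` through the translation from the cell `j` to the cell `i`
turns it into the multiplier on the cell `i`. -/
lemma shiftVec_mul_gridHom_single (i j : Fin N → Fin n) (A : Matrix (Fin M) (Fin M) ℂ) :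
    shiftVec (corner n j - corner n i) * gridHom M n (Pi.single j A) =
      gridHom M n (Pi.single i A) * shiftVec (corner n j - corner n i) := by
  refine shiftVec_mul_mulOp _ (comp_cellIdx_mem_regulated _) (comp_cellIdx_mem_regulated _)
    fun x => ?_
  have h := cellIdx_add_corner i j x
  by_cases hx : cellIdx n x = i
  · rw [hx, h.2 hx, Pi.single_eq_same, Pi.single_eq_same]
  · rw [Pi.single_eq_of_ne hx, Pi.single_eq_of_ne (fun e => hx (h.1 e))]

/-- The matrix unit that moves the `j.2`-th component of a function on the cell `j.1` to the
`i.2`-th component on the cell `i.1`. -/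
def matUnit (i j : (Fin N → Fin n) × Fin M) : L2 N M →L[ℂ] L2 N M :=
  gridHom M n (Pi.single i.1 (Matrix.single i.2 j.2 1)) * shiftVec (corner n j.1 - corner n i.1)

lemma gridHom_eq_sum (F : (Fin N → Fin n) → Matrix (Fin M) (Fin M) ℂ) :
    gridHom M n F = ∑ c, ∑ a, ∑ b, F c a b • matUnit (c, a) (c, b) := by
  simp only [matUnit, sub_self, shiftVec_zero, mul_one, ← map_smul, ← map_sum]
  congr 1
  funext c
  ext a b
  simp only [Finset.sum_apply, Matrix.sum_apply]
  rw [Finset.sum_eq_single c]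
  · conv_lhs => rw [Matrix.matrix_eq_sum_single (F c)]
    simp [Matrix.sum_apply, Matrix.single_apply]
  · intro c' _ hc
    simp [Pi.single_eq_of_ne hc.symm]
  · simp

lemma isMatrixUnits_matUnit :
    IsMatrixUnits (matUnit : (Fin N → Fin n) × Fin M → _ → L2 N M →L[ℂ] L2 N M) where
  mul_eq i j l := by
    rw [matUnit, matUnit, mul_assoc, ← mul_assoc (shiftVec _), shiftVec_mul_gridHom_single,
      mul_assoc, shiftVec_mul, ← mul_assoc, ← map_mul, ← Pi.single_mul,
      Matrix.single_mul_single_same, one_mul, matUnit]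
    congr 2
    abel
  mul_ne i j k l hjk := by
    rw [matUnit, matUnit, ← shiftVec_mul_gridHom_single, mul_assoc, ← mul_assoc (gridHom M n _),
      ← map_mul]
    have : (Pi.single j.1 (Matrix.single i.2 j.2 1) * Pi.single k.1 (Matrix.single k.2 l.2 1) :
        (Fin N → Fin n) → Matrix (Fin M) (Fin M) ℂ) = 0 := by
      by_cases h1 : j.1 = k.1
      · rw [h1, ← Pi.single_mul, Matrix.single_mul_single_of_ne, Pi.single_zero]
        exact fun h2 => hjk (Prod.ext h1 h2)
      · funext c
        by_cases hc : c = j.1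
        · subst hc
          simp [Pi.single_eq_of_ne h1]
        · simp [Pi.single_eq_of_ne hc]
    rw [this, map_zero, zero_mul, mul_zero]
  star_eq i j := by
    rw [matUnit, star_mul, star_shiftVec, ← map_star, neg_sub, ← Pi.single_star,
      shiftVec_mul_gridHom_single, matUnit, Matrix.star_eq_conjTranspose,
      Matrix.conjTranspose_single, star_one]
  sum_eq := by
    rw [← map_one (gridHom M n), gridHom_eq_sum, Fintype.sum_prod_type]
    refine Finset.sum_congr rfl fun c _ => Finset.sum_congr rfl fun a _ => ?_
    rw [Finset.sum_eq_single a] <;> simp +contextual [eq_comm]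

lemma matUnit_shift (t : Torus N) (c c' : Fin N → Fin n) (h : corner n c' = corner n c + t)
    (a : Fin M) : matUnit (c, a) (c', a) = matUnit (c, a) (c, a) * shiftVec t := by
  simp [matUnit, h, shiftVec_zero]

end Grid

open UHF
open scoped Nat

/-! ### Refinement of grids -/

/-- The cell `r * c + d` of mesh `1 / (m * r)` in the cell `c` of mesh `1 / m`. -/
def refineEquiv {m r n : ℕ} (h : m * r = n) :
    (Fin N → Fin m) × (Fin N → Fin r) ≃ (Fin N → Fin n) :=
  (Equiv.arrowProdEquivProdArrow _ _ _).symm.trans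
    ((Equiv.refl _).arrowCongr (finProdFinEquiv.trans (finCongr h)))

section Refine

variable {m r n : ℕ} (h : m * r = n)

lemma refineEquiv_apply (c : Fin N → Fin m) (d : Fin N → Fin r) (i : Fin N) :
    ((refineEquiv h (c, d) i : Fin n) : ℕ) = d i + r * c i := rfl

lemma pos_of_mul_eq [NeZero n] (h : m * r = n) : 0 < r :=
  Nat.pos_of_ne_zero fun h0 => NeZero.ne n (by rw [← h, h0, mul_zero])

variable [NeZero m] [NeZero n]

lemma cellIdx_of_refine (x : Torus N) (c : Fin N → Fin m) (d : Fin N → Fin r)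
    (hx : cellIdx n x = refineEquiv h (c, d)) : cellIdx m x = c := by
  funext i
  apply Fin.ext
  change (arcIdx m (x i) : ℕ) = _
  rw [arcIdx_div h.symm]
  change (cellIdx n x i : ℕ) / r = _
  have hr := pos_of_mul_eq h
  rw [hx, refineEquiv_apply, Nat.add_mul_div_left _ _ hr, Nat.div_eq_of_lt (d i).2, zero_add]

/-- Two cells of the coarse grid differ by the same vector as any two subcells in the same relative
position, so that a coarse matrix unit is a sum of fine ones. -/
lemma corner_refineEquiv_sub (c c' : Fin N → Fin m) (d : Fin N → Fin r) :
    corner n (refineEquiv h (c', d)) - corner n (refineEquiv h (c, d)) =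
      corner m c' - corner m c := by
  funext i
  have hr : (r : ℝ) ≠ 0 := by exact_mod_cast (pos_of_mul_eq h).ne'
  have hm : (m : ℝ) ≠ 0 := by exact_mod_cast NeZero.ne m
  simp only [Pi.sub_apply, corner, gridPt_sub]
  simp only [gridPt, refineEquiv_apply, ← h]
  congr 1
  push_cast
  field_simp
  ring

/-- The indicator of a cell is the sum of the indicators of its subcells. -/
lemma gridHom_single_eq_sum_refine (c : Fin N → Fin m) (A : Matrix (Fin M) (Fin M) ℂ) :
    gridHom M m (Pi.single c A) =
      ∑ d : Fin N → Fin r, gridHom M n (Pi.single (refineEquiv h (c, d)) A) := by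
  rw [← map_sum, gridHom_apply, gridHom_apply]
  congr 1
  funext x
  obtain ⟨⟨c', d'⟩, hx⟩ := (refineEquiv h).surjective (cellIdx n x)
  rw [← hx, cellIdx_of_refine h x c' d' hx.symm, Finset.sum_apply]
  by_cases hc : c' = c
  · subst hc
    rw [Finset.sum_eq_single d']
    · simp
    · intro d _ hd
      exact Pi.single_eq_of_ne (fun e => hd (by simpa using e.symm)) _
    · simp
  · rw [Pi.single_eq_of_ne hc]
    refine (Finset.sum_eq_zero fun d _ => Pi.single_eq_of_ne (fun e => hc ?_) _).symm
    simpa using congrArg Prod.fst ((refineEquiv h).injective e)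

lemma matUnit_eq_sum_refine (i j : (Fin N → Fin m) × Fin M) :
    matUnit i j = ∑ d : Fin N → Fin r,
      matUnit (refineEquiv h (i.1, d), i.2) (refineEquiv h (j.1, d), j.2) := by
  simp only [matUnit, corner_refineEquiv_sub, ← Finset.sum_mul]
  rw [gridHom_single_eq_sum_refine h]

end Refine

/-! ### The representation of the inductive limit -/

lemma mul_pow_factorial_succ (N M k : ℕ) :
    M * k ! ^ N * (k + 1) ^ N = M * (k + 1)! ^ N := by
  rw [mul_assoc, ← mul_pow, Nat.factorial_succ, mul_comm (k !)]

lemma factorial_mul_succ (k : ℕ) : k ! * (k + 1) = (k + 1)! := by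
  rw [Nat.factorial_succ, mul_comm]

/-- An enumeration of the pairs of a cell of mesh `1 / k!` and a component, chosen such that
passing from `k` to `k + 1` refines the cells along the diagonal blocks of
`a ↦ diag(a, …, a)`. -/
def cellEquiv (N M : ℕ) : ∀ k : ℕ, Fin (M * k ! ^ N) ≃ (Fin N → Fin k !) × Fin M
  | 0 => (Fintype.equivFinOfCardEq (by
      rw [Fintype.card_prod, Fintype.card_fun, Fintype.card_fin, Fintype.card_fin,
        Fintype.card_fin, mul_comm])).symm
  | k + 1 => (blockEquiv (mul_pow_factorial_succ N M k)).symm.trans <|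
      (Equiv.prodCongr finFunctionFinEquiv.symm (cellEquiv N M k)).trans <|
        (Equiv.prodAssoc _ _ _).symm.trans <|
          ((Equiv.prodComm _ _).trans (refineEquiv (factorial_mul_succ k))).prodCongr
            (Equiv.refl _)

lemma cellEquiv_succ_blockEquiv (k : ℕ) (d : Fin ((k + 1) ^ N)) (i : Fin (M * k ! ^ N)) :
    cellEquiv N M (k + 1) (blockEquiv (mul_pow_factorial_succ N M k) (d, i)) =
      (refineEquiv (factorial_mul_succ k) ((cellEquiv N M k i).1, finFunctionFinEquiv.symm d),
        (cellEquiv N M k i).2) := by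
  simp [cellEquiv]

lemma isMatrixUnits_level (N M k : ℕ) : IsMatrixUnits fun i j : Fin (M * k ! ^ N) =>
    (matUnit (cellEquiv N M k i) (cellEquiv N M k j) : L2 N M →L[ℂ] L2 N M) :=
  isMatrixUnits_matUnit.reindex _

/-- The representation of a full matrix algebra on `L²(𝕋ᴺ → ℂᴹ)` by the matrix units of the grid of
mesh `1 / k!`. -/
def levelHom (N M k : ℕ) :
    Matrix (Fin (M * k ! ^ N)) (Fin (M * k ! ^ N)) ℂ →⋆ₐ[ℂ] (L2 N M →L[ℂ] L2 N M) :=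
  (isMatrixUnits_level N M k).hom

lemma matUnit_mem_range_levelHom (k : ℕ) (i j : (Fin N → Fin k !) × Fin M) :
    matUnit i j ∈ Set.range (levelHom N M k) :=
  ⟨Matrix.single ((cellEquiv N M k).symm i) ((cellEquiv N M k).symm j) 1, by
    rw [levelHom, IsMatrixUnits.hom_single]; simp⟩

lemma mul_pow_factorial_dvd (N M : ℕ) {k l : ℕ} (h : k ≤ l) : M * k ! ^ N ∣ M * l ! ^ N :=
  mul_dvd_mul_left _ (pow_dvd_pow_of_dvd (Nat.factorial_dvd_factorial h) _)

section NeZero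

variable [NeZero M]

lemma levelHom_blockDiagHom {k l : ℕ} (h : k ≤ l)
    (a : Matrix (Fin (M * k ! ^ N)) (Fin (M * k ! ^ N)) ℂ) :
    levelHom N M l (blockDiagHom _ _ (mul_pow_factorial_dvd N M h) a) = levelHom N M k a := by
  induction l, h using Nat.le_induction with
  | base => rw [blockDiagHom_self]
  | succ l hl ih =>
    rw [← ih, ← blockDiagHom_comp _ _ _ (mul_pow_factorial_dvd N M hl)
      (mul_pow_factorial_dvd N M l.le_succ)]
    refine hom_blockDiagHom (mul_pow_factorial_succ N M l) _ _ _ (fun i j => ?_) _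
    rw [matUnit_eq_sum_refine (factorial_mul_succ l), ← finFunctionFinEquiv.symm.sum_comp]
    simp only [cellEquiv_succ_blockEquiv]

variable [NeZero N]

lemma factorial_dvd_mul_pow (N M n : ℕ) [NeZero N] : n ! ∣ M * n ! ^ N :=
  (dvd_pow_self _ (NeZero.ne N)).mul_left _

/-- The representation of the inductive limit of the algebras `ℂ^{n!×n!}` on `L²(𝕋ᴺ → ℂᴹ)`. Since
`n!` divides `M * (n!) ^ N`, it is given on `ℂ^{n!×n!}` by diagonal blocks in the matrix algebra of
the grid of mesh `1 / n!`. -/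
def uhfHom (N M : ℕ) [NeZero N] [NeZero M] : Algebraic →⋆ₐ[ℂ] (L2 N M →L[ℂ] L2 N M) :=
  Algebraic.lift
    (fun n => (levelHom N M n).comp (blockDiagHom _ _ (factorial_dvd_mul_pow N M n)))
    fun m n h a => by
      simp only [StarAlgHom.comp_apply, conn]
      rw [blockDiagHom_comp, ← levelHom_blockDiagHom h, blockDiagHom_comp]

lemma uhfHom_mk (n : ℕ) (a : Matrix (Fin n !) (Fin n !) ℂ) :
    uhfHom N M (Algebraic.mk n a) =
      levelHom N M n (blockDiagHom _ _ (factorial_dvd_mul_pow N M n) a) := rfl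

/-- The two systems `ℂ^{n!×n!}` and `ℂ^{P×P}`, `P = M * (k!) ^ N`, are cofinal in each other. -/
lemma levelHom_mem_range_uhfHom (k : ℕ) (a : Matrix (Fin (M * k ! ^ N)) (Fin (M * k ! ^ N)) ℂ) :
    levelHom N M k a ∈ (uhfHom N M).range := by
  let n := k + M * k ! ^ N
  have h1 : M * k ! ^ N ∣ n ! :=
    Nat.dvd_factorial (Nat.pos_of_ne_zero (NeZero.ne _)) (Nat.le_add_left _ _)
  refine ⟨Algebraic.mk n (blockDiagHom _ _ h1 a), ?_⟩
  refine (uhfHom_mk n _).trans ?_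
  rw [blockDiagHom_comp, ← levelHom_blockDiagHom (Nat.le_add_right k (M * k ! ^ N))]

lemma matUnit_mem_range_uhfHom (k : ℕ) (i j : (Fin N → Fin k !) × Fin M) :
    matUnit i j ∈ (uhfHom N M).range := by
  obtain ⟨a, ha⟩ := matUnit_mem_range_levelHom k i j
  rw [← ha]
  exact levelHom_mem_range_uhfHom k a

end NeZero

/-! ### The range of the representation -/

lemma mulOp_mem_finDiffAlgebraic {S : Torus N → Matrix (Fin M) (Fin M) ℂ}
    (hS : S ∈ Regulated N M) : mulOp S hS ∈ Algebra.adjoin ℂ (generators N M) :=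
  Algebra.subset_adjoin (Or.inr ⟨S, hS, rfl⟩)

lemma shiftOp_eq {h : ℚ} (hh : h ≠ 0) (i : Fin N) :
    (shiftOp i h : L2 N M →L[ℂ] L2 N M) = (h : ℂ) • diffOp i h + 1 := by
  rw [diffOp, smul_smul, mul_inv_cancel₀ (by exact_mod_cast hh), one_smul, sub_add_cancel]

lemma shiftOp_mem_finDiffAlgebraic (i : Fin N) (h : ℚ) :
    (shiftOp i h : L2 N M →L[ℂ] L2 N M) ∈ Algebra.adjoin ℂ (generators N M) := by
  by_cases hh : h = 0
  · subst hh
    rw [shiftOp_eq_shiftVec, Rat.cast_zero, AddCircle.coe_zero, Pi.single_zero, shiftVec_zero]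
    exact one_mem _
  · rw [shiftOp_eq hh]
    have hd : (diffOp i h : L2 N M →L[ℂ] L2 N M) ∈ Algebra.adjoin ℂ (generators N M) :=
      Algebra.subset_adjoin (Or.inl ⟨i, h, hh, rfl⟩)
    exact add_mem (Subalgebra.smul_mem _ hd _) (one_mem _)

lemma shiftVec_mem_finDiffAlgebraic (t : Fin N → ℚ) :
    (shiftVec (fun i => ((t i : ℝ) : UnitAddCircle)) : L2 N M →L[ℂ] L2 N M) ∈
      Algebra.adjoin ℂ (generators N M) := by
  -- The vectors whose translation lies in the algebra form a submonoid, which contains the rational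
  -- multiples of the basis vectors.
  let G : AddSubmonoid (Torus N) :=
    { carrier := {s | (shiftVec s : L2 N M →L[ℂ] L2 N M) ∈ Algebra.adjoin ℂ (generators N M)}
      zero_mem' := by
        change (shiftVec 0 : L2 N M →L[ℂ] L2 N M) ∈ Algebra.adjoin ℂ (generators N M)
        rw [shiftVec_zero]
        exact one_mem _
      add_mem' := fun {s t} hs ht => by
        change (shiftVec (s + t) : L2 N M →L[ℂ] L2 N M) ∈ Algebra.adjoin ℂ (generators N M)
        rw [← shiftVec_mul]
        exact mul_mem hs ht }
  change (fun i => ((t i : ℝ) : UnitAddCircle)) ∈ G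
  rw [← Finset.univ_sum_single (fun i => ((t i : ℝ) : UnitAddCircle))]
  exact sum_mem fun i _ => shiftOp_mem_finDiffAlgebraic i (t i)

lemma matUnit_mem_finDiffAlgebraic {n : ℕ} [NeZero n] (i j : (Fin N → Fin n) × Fin M) :
    matUnit i j ∈ finDiffAlgebraic N M := by
  refine mul_mem (mulOp_mem_finDiffAlgebraic (comp_cellIdx_mem_regulated _)) ?_
  have : corner n j.1 - corner n i.1 =
      fun k => ((((((j.1 k : ℕ) : ℚ) - (i.1 k : ℕ)) / n : ℚ) : ℝ) : UnitAddCircle) := by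
    funext k
    simp only [Pi.sub_apply, corner, gridPt_sub]
    rw [gridPt]
    congr 1
    push_cast
    ring
  rw [this]
  exact shiftVec_mem_finDiffAlgebraic _

lemma exists_eq_intCast_div {q : ℚ} {n : ℕ} [NeZero n] (h : q.den ∣ n) :
    ∃ a : ℤ, q = a / n := by
  obtain ⟨r, rfl⟩ := h
  have hr : (r : ℚ) ≠ 0 := fun h0 => NeZero.ne (q.den * r) (by simp [Nat.cast_eq_zero.1 h0])
  refine ⟨q.num * r, ?_⟩
  push_cast
  rw [mul_div_mul_right _ _ hr, Rat.num_div_den]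

/-- The value of a step function on a cell is its value at the corner, as soon as the mesh of the
grid is a common denominator of the end points. -/
lemma stepFun_corner {P n : ℕ} [NeZero n] (p q : Fin P → Fin N → ℚ)
    (C : Fin P → Matrix (Fin M) (Fin M) ℂ) (hp : ∀ k i, (p k i).den ∣ n)
    (hq : ∀ k i, (q k i).den ∣ n) (x : Torus N) :
    stepFun p q C (corner n (cellIdx n x)) = stepFun p q C x := by
  refine Finset.sum_congr rfl fun k _ => ?_
  have : corner n (cellIdx n x) ∈ box (p k) (q k) ↔ x ∈ box (p k) (q k) := by
    simp only [box, Set.mem_univ_pi]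
    refine forall_congr' fun i => ?_
    obtain ⟨a, ha⟩ := exists_eq_intCast_div (hp k i)
    obtain ⟨b, hb⟩ := exists_eq_intCast_div (hq k i)
    rw [ha, hb]
    exact gridPt_arcIdx_mem_arc a b (x i)
  by_cases hx : x ∈ box (p k) (q k)
  · rw [Set.indicator_of_mem hx, Set.indicator_of_mem (this.2 hx)]
  · rw [Set.indicator_of_notMem hx, Set.indicator_of_notMem (mt this.1 hx)]

section Range

variable [NeZero N] [NeZero M]

lemma gridHom_mem_range_uhfHom (k : ℕ) (F : (Fin N → Fin k !) → Matrix (Fin M) (Fin M) ℂ) :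
    gridHom M k ! F ∈ (uhfHom N M).range := by
  rw [gridHom_eq_sum]
  exact sum_mem fun c _ => sum_mem fun a _ => sum_mem fun b _ =>
    SMulMemClass.smul_mem _ (matUnit_mem_range_uhfHom k _ _)

lemma shiftOp_mem_range_uhfHom (i : Fin N) (h : ℚ) : shiftOp i h ∈ (uhfHom N M).range := by
  -- On the grid of mesh `1 / k!`, `k = h.den`, the translation permutes the cells: it maps the
  -- corner of `c` to the corner of `g c`.
  let k := h.den
  obtain ⟨z, hz⟩ : ∃ z : ℤ, h = z / (k ! : ℕ) :=
    exists_eq_intCast_div (Nat.dvd_factorial h.den_pos le_rfl)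
  have hc : ∀ c : Fin N → Fin k !, ∃ c' : Fin N → Fin k !,
      corner k ! c' = corner k ! c + Pi.single i ((h : ℝ) : UnitAddCircle) := fun c => by
    obtain ⟨d, hd⟩ := exists_gridPt_eq (n := k !) ((c i : ℕ) + z)
    refine ⟨Function.update c i d, ?_⟩
    funext j
    by_cases hj : j = i
    · subst hj
      simp only [corner, Function.update_self, Pi.add_apply, Pi.single_eq_same, hd]
      simp only [gridPt, hz, ← AddCircle.coe_add]
      congr 1
      push_cast
      ring
    · simp [corner, Function.update_of_ne hj, Pi.single_eq_of_ne hj]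
  choose g hg using hc
  have : (shiftOp i h : L2 N M →L[ℂ] L2 N M) =
      ∑ j : (Fin N → Fin k !) × Fin M, matUnit j (g j.1, j.2) := by
    rw [← one_mul (shiftOp i h), ← isMatrixUnits_matUnit (n := k !).sum_eq, Finset.sum_mul]
    exact Finset.sum_congr rfl fun j _ => (matUnit_shift _ j.1 (g j.1) (hg j.1) j.2).symm
  rw [this]
  exact sum_mem fun j _ => matUnit_mem_range_uhfHom k _ _

lemma mulOp_mem_closure_range_uhfHom {S : Torus N → Matrix (Fin M) (Fin M) ℂ}
    (hS : S ∈ Regulated N M) : mulOp S hS ∈ closure (Set.range (uhfHom N M)) := by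
  rw [Metric.mem_closure_iff]
  intro ε hε
  obtain ⟨P, p, q, C, h⟩ := hS (ε / 2) (half_pos hε)
  let k := ∑ n, ∑ i, ((p n i).den + (q n i).den)
  have hk : ∀ n i, (p n i).den + (q n i).den ≤ k := fun n i =>
    (Finset.single_le_sum (f := fun i => (p n i).den + (q n i).den) (fun _ _ => Nat.zero_le _)
      (Finset.mem_univ i)).trans
    (Finset.single_le_sum (f := fun n => ∑ i, ((p n i).den + (q n i).den))
      (fun _ _ => Nat.zero_le _) (Finset.mem_univ n))
  have hp : ∀ n i, (p n i).den ∣ k ! := fun n i =>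
    Nat.dvd_factorial (p n i).den_pos ((Nat.le_add_right _ _).trans (hk n i))
  have hq : ∀ n i, (q n i).den ∣ k ! := fun n i =>
    Nat.dvd_factorial (q n i).den_pos ((Nat.le_add_left _ _).trans (hk n i))
  refine ⟨gridHom M k ! fun c => stepFun p q C (corner k ! c),
    gridHom_mem_range_uhfHom k _, ?_⟩
  rw [dist_eq_norm, gridHom_apply]
  refine (norm_mulOp_sub_le _ _ (half_pos hε).le fun x => ?_).trans_lt (half_lt_self hε)
  rw [stepFun_corner p q C hp hq]
  exact h x

/-- The algebra of finite differential operators is the closure of the image of the inductive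
limit of full matrix algebras. -/
theorem coe_finDiffAlg_eq_closure :
    (finDiffAlg N M : Set (L2 N M →L[ℂ] L2 N M)) = closure (Set.range (uhfHom N M)) := by
  apply Set.Subset.antisymm
  · have hle : Algebra.adjoin ℂ (generators N M) ≤
        (uhfHom N M).range.topologicalClosure.toSubalgebra := by
      refine Algebra.adjoin_le ?_
      rintro A (⟨i, h, hh, rfl⟩ | ⟨S, hS, rfl⟩)
      · exact subset_closure (SMulMemClass.smul_mem _
          (sub_mem (shiftOp_mem_range_uhfHom i h) (one_mem _)))
      · exact mulOp_mem_closure_range_uhfHom hS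
    exact closure_minimal hle isClosed_closure
  · refine closure_mono ?_
    rintro _ ⟨x, rfl⟩
    obtain ⟨n, a, rfl⟩ := Algebraic.exists_mk x
    rw [uhfHom_mk, levelHom, IsMatrixUnits.hom_apply]
    exact sum_mem fun i _ => sum_mem fun j _ =>
      SMulMemClass.smul_mem _ (matUnit_mem_finDiffAlgebraic _ _)

end Range

/-! ### The cyclic vector -/

/-- The unit vector `(1, …, 1) / √M`. -/
def diagVec (M : ℕ) : EuclideanSpace ℂ (Fin M) :=
  ((‖(WithLp.toLp 2 1 : EuclideanSpace ℂ (Fin M))‖ : ℂ)⁻¹) • WithLp.toLp 2 1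

lemma norm_diagVec [NeZero M] : ‖diagVec M‖ = 1 := by
  refine norm_smul_inv_norm fun h => ?_
  have := congrArg (fun v : EuclideanSpace ℂ (Fin M) => v 0) h
  simp at this

lemma diagVec_apply (a b : Fin M) : diagVec M a = diagVec M b := by
  simp [diagVec]

variable (N M) in
/-- The constant function with value `(1, …, 1) / √M`. -/
def constVec : L2 N M := Lp.const 2 volume (diagVec M)

lemma coeFn_constVec : ⇑(constVec N M) =ᵐ[volume] fun _ => diagVec M :=
  Lp.coeFn_const ..

lemma norm_constVec [NeZero M] : ‖constVec N M‖ = 1 := by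
  refine (Lp.norm_const' 2 volume (diagVec M) (by simp) (by simp)).trans ?_
  have h : volume.real (Set.univ : Set (Torus N)) = 1 := by
    rw [Measure.real, volume_pi, Measure.pi_univ]
    simp
  rw [h, norm_diagVec, Real.one_rpow, one_mul]

lemma shiftVec_constVec (t : Torus N) : shiftVec t (constVec N M) = constVec N M := by
  apply Lp.ext
  filter_upwards [coeFn_shiftVec t (constVec N M), ae_add t (coeFn_constVec (N := N) (M := M)),
    coeFn_constVec (N := N) (M := M)] with x h1 h2 h3
  rw [h1, h2, h3]

lemma matUnit_constVec {n : ℕ} [NeZero n] (i j : (Fin N → Fin n) × Fin M) :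
    matUnit i j (constVec N M) = matUnit i i (constVec N M) := by
  rw [matUnit, matUnit, mul_apply_eq_comp, mul_apply_eq_comp, shiftVec_constVec,
    shiftVec_constVec, gridHom_apply, gridHom_apply]
  apply Lp.ext
  filter_upwards [coeFn_mulOp _ (comp_cellIdx_mem_regulated
      (Pi.single i.1 (Matrix.single i.2 j.2 1))) (constVec N M),
    coeFn_mulOp _ (comp_cellIdx_mem_regulated
      (Pi.single i.1 (Matrix.single i.2 i.2 1))) (constVec N M),
    coeFn_constVec (N := N) (M := M)] with x h1 h2 h3
  rw [h1, h2, h3]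
  by_cases hx : cellIdx n x = i.1
  · rw [hx, Pi.single_eq_same, Pi.single_eq_same]
    ext a
    simp only [Matrix.ofLp_toEuclideanCLM, Matrix.mulVec, dotProduct, Matrix.single_apply]
    by_cases ha : i.2 = a
    · simp [ha, diagVec_apply a j.2]
    · simp [ha]
  · rw [Pi.single_eq_of_ne hx, Pi.single_eq_of_ne hx]

/-- Continuous functions are regulated. -/
lemma regulated_of_continuous {S : Torus N → Matrix (Fin M) (Fin M) ℂ} (hS : Continuous S) :
    S ∈ Regulated N M := by
  intro ε hε
  obtain ⟨δ, hδ, h⟩ := Metric.uniformContinuous_iff.1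
    (CompactSpace.uniformContinuous_of_continuous hS) (ε / 2) (half_pos hε)
  obtain ⟨n, hn⟩ := exists_nat_one_div_lt hδ
  obtain ⟨P, p, q, C, hC⟩ := comp_cellIdx_mem_regulated (n := n + 1)
    (fun c : Fin N → Fin (n + 1) => S (corner (n + 1) c)) (ε / 2) (half_pos hε)
  refine ⟨P, p, q, C, fun x => ?_⟩
  have hd : dist x (corner (n + 1) (cellIdx (n + 1) x)) < δ := by
    refine lt_of_le_of_lt ((dist_pi_le_iff (by positivity)).2 fun i => ?_) hn
    exact_mod_cast dist_gridPt_arcIdx_le (n := n + 1) (x i)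
  calc ‖S x - stepFun p q C x‖
      = ‖(S x - S (corner (n + 1) (cellIdx (n + 1) x))) +
          (S (corner (n + 1) (cellIdx (n + 1) x)) - stepFun p q C x)‖ := by rw [sub_add_sub_cancel]
    _ ≤ ε / 2 + ε / 2 := (norm_add_le _ _).trans
        (add_le_add (by rw [← dist_eq_norm]; exact (h hd).le) (hC x))
    _ = ε := add_halves ε

section State

variable [NeZero N] [NeZero M]

/-- The vector state of `constVec` on the inductive limit does not depend on `N` and `M`. -/
lemma inner_uhfHom_constVec (n : ℕ) (a : Matrix (Fin n !) (Fin n !) ℂ) :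
    inner ℂ (constVec N M) (uhfHom N M (Algebraic.mk n a) (constVec N M)) =
      (n ! : ℂ)⁻¹ * ∑ i, ∑ j, a i j := by
  obtain ⟨q, hq⟩ := factorial_dvd_mul_pow N M n
  refine ((isMatrixUnits_level N M n).inner_hom norm_constVec
    (fun i j => matUnit_constVec _ _) (blockDiagHom _ _ (factorial_dvd_mul_pow N M n) a)).trans ?_
  rw [sum_blockDiagHom hq.symm, Fintype.card_fin]
  have hq0 : (q : ℂ) ≠ 0 := by
    rintro h
    rw [Nat.cast_eq_zero.1 h, mul_zero] at hq
    exact NeZero.ne _ hq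
  have hn : (n ! : ℂ) ≠ 0 := by exact_mod_cast n.factorial_ne_zero
  rw [hq]
  push_cast
  field_simp

/-- A continuous function is the image of the constant vector under a multiplication operator, and
the continuous functions are dense in `L²`. -/
lemma denseRange_uhfHom_constVec : DenseRange fun x => uhfHom N M x (constVec N M) := by
  rw [DenseRange, dense_iff_closure_eq, ← Set.univ_subset_iff]
  have hd : DenseRange (ContinuousMap.toLp 2 volume ℂ :
      C(Torus N, EuclideanSpace ℂ (Fin M)) →L[ℂ] L2 N M) :=
    ContinuousMap.toLp_denseRange (p := 2) _ volume ℂ (by simp)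
  rw [← hd.closure_range]
  refine closure_minimal ?_ isClosed_closure
  rintro _ ⟨f, rfl⟩
  -- `S x` is the rank-one matrix that maps `(1, …, 1) / √M` to `f x`.
  let T := (Matrix.toEuclideanCLM (n := Fin M) (𝕜 := ℂ)).symm
  have hT : Continuous T := T.toAlgEquiv.toLinearMap.continuous_of_finiteDimensional
  let S : Torus N → Matrix (Fin M) (Fin M) ℂ := fun x =>
    T ((innerSL ℂ (diagVec M)).smulRight (f x))
  have hS : S ∈ Regulated N M := regulated_of_continuous <| hT.comp <|
    ((ContinuousLinearMap.smulRightL ℂ _ _ (innerSL ℂ (diagVec M))).continuous.comp f.continuous)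
  have hf : ContinuousMap.toLp 2 volume ℂ f = mulOp S hS (constVec N M) := by
    apply Lp.ext
    filter_upwards [ContinuousMap.coeFn_toLp (p := 2) (𝕜 := ℂ) volume f,
      coeFn_mulOp S hS (constVec N M), coeFn_constVec (N := N) (M := M)] with x h1 h2 h3
    rw [h1, h2, h3]
    simp [S, T, inner_self_eq_norm_sq_to_K, norm_diagVec]
  rw [hf]
  have hcont : Continuous fun A : L2 N M →L[ℂ] L2 N M => A (constVec N M) := by fun_prop
  have := image_closure_subset_closure_image hcont
    ⟨_, mulOp_mem_closure_range_uhfHom hS, rfl⟩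
  rwa [← Set.range_comp] at this

end State

/-! ### The isomorphism and the unitary -/

/-- Conjugation by a unitary maps the closure of the range of one of two intertwined
representations onto that of the other. -/
lemma image_conj_closure_range {A H K : Type*} [NormedAddCommGroup H] [InnerProductSpace ℂ H]
    [NormedAddCommGroup K] [InnerProductSpace ℂ K] (ρ : A → H →L[ℂ] H) (τ : A → K →L[ℂ] K)
    (V : H ≃ₗᵢ[ℂ] K) (hV : ∀ x u, V (ρ x u) = τ x (V u)) :
    (fun B : K →L[ℂ] K => (V.symm : K →L[ℂ] H) ∘L B ∘L (V : H →L[ℂ] K)) ''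
      closure (Set.range τ) = closure (Set.range ρ) := by
  let e : (K →L[ℂ] K) ≃ₜ (H →L[ℂ] H) :=
    { toFun := fun B => (V.symm : K →L[ℂ] H) ∘L B ∘L (V : H →L[ℂ] K)
      invFun := fun B => (V : H →L[ℂ] K) ∘L B ∘L (V.symm : K →L[ℂ] H)
      left_inv := fun B => by ext u; simp
      right_inv := fun B => by ext u; simp
      continuous_toFun := by fun_prop
      continuous_invFun := by fun_prop }
  have he : ∀ x, e (τ x) = ρ x := fun x => by
    ext u
    change V.symm (τ x (V u)) = ρ x u
    rw [← hV, V.symm_apply_apply]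
  refine (e.image_closure _).trans ?_
  rw [← Set.range_comp]
  congr 2
  exact funext he

end FiniteDiff

end

theorem theorem1 (N M : ℕ) (hN : 0 < N) (hM : 0 < M) :
    Nonempty (FiniteDiff.finDiffAlg N M ≃⋆ₐ[ℂ] UHF.Universal) ∧
    ∃ V : FiniteDiff.L2 1 1 ≃ₗᵢ[ℂ] FiniteDiff.L2 N M,
      (FiniteDiff.finDiffAlg 1 1 : Set (FiniteDiff.L2 1 1 →L[ℂ] FiniteDiff.L2 1 1)) =
        (fun A : FiniteDiff.L2 N M →L[ℂ] FiniteDiff.L2 N M =>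
          (V.symm : FiniteDiff.L2 N M →L[ℂ] FiniteDiff.L2 1 1) ∘L A ∘L
            (V : FiniteDiff.L2 1 1 →L[ℂ] FiniteDiff.L2 N M)) '' FiniteDiff.finDiffAlg N M := by
  have : NeZero N := ⟨hN.ne'⟩
  have : NeZero M := ⟨hM.ne'⟩
  constructor
  · have : Nontrivial (FiniteDiff.L2 N M) :=
      ⟨FiniteDiff.constVec N M, 0, norm_ne_zero_iff.1 (by simp [FiniteDiff.norm_constVec])⟩
    exact UHF.nonempty_starAlgEquiv _ _ FiniteDiff.coe_finDiffAlg_eq_closure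
  · obtain ⟨V, hV⟩ := exists_unitary_intertwining (FiniteDiff.uhfHom 1 1) (FiniteDiff.uhfHom N M)
      (FiniteDiff.constVec 1 1) (FiniteDiff.constVec N M)
      FiniteDiff.denseRange_uhfHom_constVec FiniteDiff.denseRange_uhfHom_constVec fun x => by
        obtain ⟨n, a, rfl⟩ := UHF.Algebraic.exists_mk x
        rw [FiniteDiff.inner_uhfHom_constVec, FiniteDiff.inner_uhfHom_constVec]
    refine ⟨V, ?_⟩
    rw [FiniteDiff.coe_finDiffAlg_eq_closure, FiniteDiff.coe_finDiffAlg_eq_closure]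
    exact (FiniteDiff.image_conj_closure_range _ _ V hV).symm
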